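/- A mixed polynomial on $\mathbb C^n$ is a finite sum $f(z,\bar z)=\sum c_{\nu,\mu}z^\nu\bar z^\mu$. Its radial Newton polyhedron $\Gamma_+(f)$ is the convex hull of $\bigcup_{c_{\nu,\mu}\ne0}\big((\nu+\mu)+\mathbb R^n_{\ge0}\big)$. For a weight vector $P\in N^+_{\mathbb R}:=\mathbb R^n_{\ge0}$, let $d(P)$ be the minimum of $P(\xi)=\sum p_j\xi_j$ on $\Gamma_+(f)$ and $\Delta(P)=\{\xi\in\Gamma_+(f): P(\xi)=d(P)\}$ (a face of $\Gamma_+(f)$ if $P\neq0$). For a compact face $\Delta$ let $f_\Delta=\sum_{\nu+\mu\in\Delta}c_{\nu,\mu}z^\nu\bar z^\mu$, and $f_P:=f_{\Delta(P)}$. A mixed polynomial is radially (polar) weighted homogeneous of degree $d$ with respect to a weight vector $P\ne 0$ if $d$ is a positive integer with $P(\nu+\mu)=d$ (resp. $d$ is an integer with $P(\nu-\mu)=d$) whenever $c_{\nu,\mu}\ne0$; write $\operatorname{rdeg}_P$, $\operatorname{pdeg}_P$. It is strongly polar non-negative mixed weighted homogeneous with respect to $P$ if it is both with respect to the same $P$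 and $\operatorname{pdeg}_P\ge0$. $f$ is of strongly polar non-negative mixed weighted homogeneous face type if for each compact face $\Delta$ this holds for $f_\Delta$ with some strictly positive $P$ such that $\Delta=\Delta(P)$. $f$ is Newton non-degenerate if, for each compact face $\Delta$, at no zero of $f_\Delta$ in $(\mathbb C^*)^n$ the real differential of $f_\Delta$ has rank $<2$. Write $f^I$ for the restriction of $f$ to $\{z: z_j=0 \text{ for } j\notin I\}$; $f$ is convenient if $f^I\not\equiv0$ for every $I\neq\emptyset$. The dual Newton diagram $\Gamma^*(f)$ is the decomposition of $N^+_{\mathbb R}$ into the equivalence classes of $P\sim Q\Leftrightarrow\Delta(P)=\Delta(Q)$; its closed cones are the closures of the classes. A regular simplicial cone subdivision $\Sigma^*$ of $N^+_{\mathbb R}$ is a finite set of cones with support $N^+_{\mathbb R}$, each spanned by part of a basis of $\mathbb Z^n$, closed under taking faces and such that any two cones meet in a common face. It is admissible for $f$ if the relative interior of each of its cones lies in one equivalence class, and convenient for $f$ if it contains $\operatorname{Cone}(E_i: i\notin I)$ whenever $f^I\not\equiv0$, where $E_1,\dots,E_n$ is the standard basis. The toric modification $\hat\pi:X\to\mathbb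 C^n$ of $\Sigma^*$ is obtained by gluing charts $\mathbb C^n_\sigma$, one for each $n$-dimensional cone $\sigma=\operatorname{Cone}(P_1,\dots,P_n)$ of $\Sigma^*$, along the monomial maps with exponent matrices $\tau^{-1}\sigma$, with $\hat\pi(u)_i=\prod_j u_j^{(P_j)_i}$ on $\mathbb C^n_\sigma$. For a vertex $Q$ of $\Sigma^*$, the divisor $\hat E(Q)\subset X$ is $\{u_j=0\}$ in the charts with $Q=P_j$, and $\hat E(\tau)^*:=\bigcap_{P\text{ vertex of }\tau}\hat E(P)\setminus\bigcup_{Q\notin\tau}\hat E(Q)$ for $\tau\in\Sigma^*$. The strict transform $\tilde V$ of $V=f^{-1}(0)$ is the closure of $\hat\pi^{-1}(V\setminus\{0\})$ in $X$, regarded as a germ along $\tilde V\cap\hat\pi^{-1}(0)$. Let $\Lambda(\tau)$ be the minimum of the numbers $P_j(\nu+\mu)-d(P_j)$ with $c_{\nu,\mu}\neq0$, $P_j$ a vertex of $\tau$ and $\nu+\mu\notin\Delta(P_j)$, and let $L(\Sigma^*)$ be the set of the $\Lambda(\tau)$ for the cones $\tau\in\Sigma^*$ with only strictly positive vertices for which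 such numbers exist and $\tilde V\cap\hat E(\tau)^*$ meets $\mathbb C^n_\sigma$ for some $n$-dimensional cone $\sigma\in\Sigma^*$ having $\tau$ as a face. **Assumption (\*)**: each point of $\tilde V\cap\hat\pi^{-1}(0)$ has, in the chart of some $n$-dimensional cone $\sigma=\operatorname{Cone}(P_1,\dots,P_n)$ of $\Sigma^*$ (vertices suitably ordered), coordinates $(0,\dots,0,u_{\kappa+1},\dots,u_n)$ with $1\le\kappa\le n$, $u_{\kappa+1},\dots,u_n\ne0$ and $P_1,\dots,P_\kappa$ strictly positive. **Corollary.** Let $n=2$, $P=(1,1)$, and let $f$ be a convenient, Newton non-degenerate mixed polynomial that is strongly polar non-negative mixed weighted homogeneous with respect to $P$, of radial degree $r>0$ and polar degree $p\ge0$. Then: 1. The compact faces of $\Gamma_+(f)$ are exactly the $1$-dimensional face $\Delta(P)$ and the $0$-dimensional faces $\Delta(P+E_1)$, $\Delta(P+E_2)$. 2. The face functions $f_P,f_{P+E_1},f_{P+E_2}$ are non-zero, $\operatorname{rdeg}_Pf_P=r$, $\operatorname{pdeg}_Pf_P=p$ and, for $i=1,2$, $\operatorname{rdeg}_{P+E_i}f_{P+E_i}=\operatorname{rdeg}_Pf_{P+E_i}=r$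 and $\operatorname{pdeg}_{P+E_i}f_{P+E_i}=\operatorname{pdeg}_Pf_{P+E_i}=p$. 3. $f$ is of strongly polar non-negative mixed weighted homogeneous face type. 4. The closed cones of $\Gamma^*(f)$ form a regular simplicial cone subdivision $\Sigma^*$ of $N^+_{\mathbb R}$, which is admissible and convenient for $f$. 5. The associated toric modification $\hat\pi:X\to\mathbb C^2$ is the ordinary blow-up of the origin: there is a biholomorphic map from $X$ to $\{(z,\ell)\in\mathbb C^2\times\mathbb P^1: z\in\ell\}$ over $\mathbb C^2$. 6. There is no $(\nu,\mu)$ with $c_{\nu,\mu}\ne0$ and $\nu+\mu\notin\Delta(P)$, and $L(\Sigma^*)=\emptyset$. Under Assumption (\*) for $\Sigma^*$, the strict transform germ $\tilde V$ along $\tilde V\cap\hat\pi^{-1}(0)$ is a real analytic manifold (an embedded real analytic submanifold of $X$ of real dimension $2$, possibly empty). -/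

import Mathlib

open scoped ComplexConjugate LinearAlgebra.Projectivization Topology

namespace MixedToric

noncomputable section

/-! ## Mixed polynomials -/

/-- A mixed polynomial `∑ c_{ν,μ} z^ν z̄^μ` in `n` complex variables, given by its finitely many
nonzero coefficients: `f (ν, μ) = c_{ν,μ}`. -/
abbrev MixedPoly (n : ℕ) : Type := ((Fin n → ℕ) × (Fin n → ℕ)) →₀ ℂ

/-- The function `z ↦ ∑ c_{ν,μ} z^ν z̄^μ` on `ℂⁿ`. -/
def evalMixed {n : ℕ} (f : MixedPoly n) (z : Fin n → ℂ) : ℂ :=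
  f.sum fun m c => c * (∏ i, z i ^ m.1 i) * ∏ i, (conj (z i)) ^ m.2 i

/-- `a` is a mixed critical point of `f`: the real differential of `f` at `a` has rank `< 2`. -/
def IsMixedCriticalPoint {n : ℕ} (f : MixedPoly n) (a : Fin n → ℂ) : Prop :=
  Module.finrank ℝ (LinearMap.range (fderiv ℝ (evalMixed f) a).toLinearMap) < 2

/-! ## The radial Newton polyhedron, its faces, face functions -/

/-- A natural (or integral, nonnegative) vector as a vector of `ℝⁿ`. -/
def toReal {n : ℕ} (p : Fin n → ℕ) : Fin n → ℝ := fun i => (p i : ℝ)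

/-- The linear function `ξ ↦ P(ξ) = ∑ p_j ξ_j`. -/
def pairing {n : ℕ} (P ξ : Fin n → ℝ) : ℝ := ∑ j, P j * ξ j

/-- The cone `N⁺_ℝ` of weight vectors (the zero vector included). -/
def weightCone (n : ℕ) : Set (Fin n → ℝ) := {P | ∀ i, 0 ≤ P i}

/-- A weight vector is strictly positive. -/
def StrictlyPositive {n : ℕ} (P : Fin n → ℝ) : Prop := ∀ i, 0 < P i

/-- The radial Newton polyhedron `Γ₊(f)`. -/
def newtonPolyhedron {n : ℕ} (f : MixedPoly n) : Set (Fin n → ℝ) :=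
  convexHull ℝ {x | ∃ ν μ : Fin n → ℕ, f (ν, μ) ≠ 0 ∧ ∀ i, toReal (ν + μ) i ≤ x i}

/-- The minimum `d(P)` of `P` on `Γ₊(f)`. -/
def minValue {n : ℕ} (f : MixedPoly n) (P : Fin n → ℝ) : ℝ :=
  sInf (pairing P '' newtonPolyhedron f)

/-- The face `Δ(P)` of `Γ₊(f)`. -/
def face {n : ℕ} (f : MixedPoly n) (P : Fin n → ℝ) : Set (Fin n → ℝ) :=
  {ξ | ξ ∈ newtonPolyhedron f ∧ pairing P ξ = minValue f P}

/-- `Δ` is a compact face of `Γ₊(f)`. -/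
def IsCompactFace {n : ℕ} (f : MixedPoly n) (Δ : Set (Fin n → ℝ)) : Prop :=
  IsCompact Δ ∧ ∃ P ∈ weightCone n, P ≠ 0 ∧ Δ = face f P

/-- The (nonempty) convex set `Δ` has dimension `d`. -/
def HasDim {n : ℕ} (Δ : Set (Fin n → ℝ)) (d : ℕ) : Prop :=
  Δ.Nonempty ∧ Module.finrank ℝ (vectorSpan ℝ Δ) = d

open Classical in
/-- The face function `f_Δ`: the sum of the terms of `f` with `ν + μ ∈ Δ`. -/
def faceFunction {n : ℕ} (f : MixedPoly n) (Δ : Set (Fin n → ℝ)) : MixedPoly n :=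
  Finsupp.filter (fun m : (Fin n → ℕ) × (Fin n → ℕ) => toReal (m.1 + m.2) ∈ Δ) f

/-! ## Weighted homogeneity -/

/-- `f` is radially weighted homogeneous for the weight vector `Q`, of radial degree `d`. -/
def HasRadialDegree {n : ℕ} (f : MixedPoly n) (Q : Fin n → ℝ) (d : ℕ) : Prop :=
  Q ∈ weightCone n ∧ Q ≠ 0 ∧ 0 < d ∧
    ∀ ν μ : Fin n → ℕ, f (ν, μ) ≠ 0 → ∑ i, Q i * ((ν i : ℝ) + (μ i : ℝ)) = (d : ℝ)

/-- `f` is polar weighted homogeneous for the weight vector `P`, of polar degree `d`. -/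
def HasPolarDegree {n : ℕ} (f : MixedPoly n) (P : Fin n → ℝ) (d : ℤ) : Prop :=
  P ∈ weightCone n ∧ P ≠ 0 ∧
    ∀ ν μ : Fin n → ℕ, f (ν, μ) ≠ 0 → ∑ i, P i * ((ν i : ℝ) - (μ i : ℝ)) = (d : ℝ)

/-- `f` is a strongly polar non-negative mixed weighted homogeneous polynomial with respect to
the weight vector `P` (the same one for both degrees). -/
def IsStronglyPolarNonneg {n : ℕ} (f : MixedPoly n) (P : Fin n → ℝ) : Prop :=
  (∃ dr : ℕ, HasRadialDegree f P dr) ∧ ∃ dp : ℤ, 0 ≤ dp ∧ HasPolarDegree f P dp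

/-- `f` is of strongly polar non-negative mixed weighted homogeneous face type. -/
def IsStronglyPolarNonnegFaceType {n : ℕ} (f : MixedPoly n) : Prop :=
  ∀ Δ, IsCompactFace f Δ →
    ∃ P, StrictlyPositive P ∧ Δ = face f P ∧ IsStronglyPolarNonneg (faceFunction f Δ) P

/-! ## Newton non-degeneracy and convenience -/

/-- `0` is not a mixed critical value of `f_Δ : (ℂ^*)ⁿ → ℂ`. -/
def IsNondegenerateOver {n : ℕ} (f : MixedPoly n) (Δ : Set (Fin n → ℝ)) : Prop :=
  ∀ z : Fin n → ℂ, (∀ i, z i ≠ 0) → evalMixed (faceFunction f Δ) z = 0 →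
    ¬ IsMixedCriticalPoint (faceFunction f Δ) z

/-- Newton non-degeneracy: non-degenerate over every compact face. -/
def IsNewtonNondegenerate {n : ℕ} (f : MixedPoly n) : Prop :=
  ∀ Δ, IsCompactFace f Δ → IsNondegenerateOver f Δ

/-- `f^I ≢ 0`: the restriction of `f` to `ℂ^I = {z | z_j = 0 for j ∉ I}` is not zero. -/
def RestrictionNonzero {n : ℕ} (f : MixedPoly n) (I : Finset (Fin n)) : Prop :=
  ∃ z : Fin n → ℂ, (∀ j, j ∉ I → z j = 0) ∧ evalMixed f z ≠ 0

/-- `f` is convenient: `f^I ≢ 0` for all nonempty `I`. -/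
def IsConvenient {n : ℕ} (f : MixedPoly n) : Prop :=
  ∀ I : Finset (Fin n), I.Nonempty → RestrictionNonzero f I

/-! ## Regular simplicial cone subdivisions of `N⁺_ℝ`

A regular simplicial cone is given by its finite set of (primitive, integral) vertices, and a
subdivision by a set of such vertex sets. -/

/-- The closed cone spanned by the vertices `τ`. -/
def cone {n : ℕ} (τ : Finset (Fin n → ℕ)) : Set (Fin n → ℝ) :=
  {x | ∃ r : (Fin n → ℕ) → ℝ, (∀ p ∈ τ, 0 ≤ r p) ∧ x = ∑ p ∈ τ, r p • toReal p}

/-- The interior `Int τ` of the cone spanned by `τ`. -/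
def coneInterior {n : ℕ} (τ : Finset (Fin n → ℕ)) : Set (Fin n → ℝ) :=
  {x | ∃ r : (Fin n → ℕ) → ℝ, (∀ p ∈ τ, 0 < r p) ∧ x = ∑ p ∈ τ, r p • toReal p}

/-- The vertices `τ` are part of a basis of the lattice `ℤⁿ`. -/
def IsRegularCone {n : ℕ} (τ : Finset (Fin n → ℕ)) : Prop :=
  ∃ b : Module.Basis (Fin n) ℤ (Fin n → ℤ), ∀ p ∈ τ, ∃ i, b i = fun j => (p j : ℤ)

/-- `S` is a regular simplicial cone subdivision of `N⁺_ℝ`. -/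
structure IsRegularSubdivision {n : ℕ} (S : Set (Finset (Fin n → ℕ))) : Prop where
  finite : S.Finite
  regular : ∀ τ ∈ S, IsRegularCone τ
  face_mem : ∀ τ ∈ S, ∀ ρ, ρ ⊆ τ → ρ ∈ S
  inter_face : ∀ τ ∈ S, ∀ τ' ∈ S, ∃ ρ, ρ ⊆ τ ∧ ρ ⊆ τ' ∧ cone τ ∩ cone τ' = cone ρ
  support : (⋃ τ ∈ S, cone τ) = weightCone n

/-- The set of vertices of a subdivision. -/
def vertices {n : ℕ} (S : Set (Finset (Fin n → ℕ))) : Set (Fin n → ℕ) := {p | ∃ τ ∈ S, p ∈ τ}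

/-- The canonical vector `E_j`. -/
def stdVec {n : ℕ} (j : Fin n) : Fin n → ℕ := Pi.single j 1

/-- The (vertex set of the) cone `E_I`. -/
def stdCone {n : ℕ} (I : Finset (Fin n)) : Finset (Fin n → ℕ) := I.image stdVec

/-! ## The dual Newton diagram -/

/-- The equivalence class of the weight vector `P`: those `Q` with `Δ(Q) = Δ(P)`. -/
def dualClass {n : ℕ} (f : MixedPoly n) (P : Fin n → ℝ) : Set (Fin n → ℝ) :=
  {Q | Q ∈ weightCone n ∧ face f Q = face f P}

/-- The closed cones of the dual Newton diagram `Γ^*(f)`: the closures of the equivalence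
classes. -/
def dualNewtonDiagram {n : ℕ} (f : MixedPoly n) : Set (Set (Fin n → ℝ)) :=
  {C | ∃ P ∈ weightCone n, C = closure (dualClass f P)}

/-- The vertex sets of those closed cones of `Γ^*(f)` that are regular simplicial. -/
def dualSubdivision {n : ℕ} (f : MixedPoly n) : Set (Finset (Fin n → ℕ)) :=
  {τ | IsRegularCone τ ∧ cone τ ∈ dualNewtonDiagram f}

/-- The dual Newton diagram gives already a regular simplicial cone subdivision of `N⁺_ℝ`: each
of its closed cones is regular simplicial, and these cones form a subdivision. -/
def DualDiagramIsRegularSubdivision {n : ℕ} (f : MixedPoly n) : Prop :=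
  cone '' dualSubdivision f = dualNewtonDiagram f ∧ IsRegularSubdivision (dualSubdivision f)

/-- The cone `τ` is admissible for `Γ^*(f)`: `Int τ` lies in the class of `P_τ = ∑ P_i`. -/
def IsAdmissibleCone {n : ℕ} (f : MixedPoly n) (τ : Finset (Fin n → ℕ)) : Prop :=
  coneInterior τ ⊆ dualClass f (∑ p ∈ τ, toReal p)

/-- The subdivision `S` is admissible for `f`. -/
def IsAdmissible {n : ℕ} (f : MixedPoly n) (S : Set (Finset (Fin n → ℕ))) : Prop :=
  ∀ τ ∈ S, IsAdmissibleCone f τ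

/-- The subdivision `S` is convenient for `f`: it contains `E_{I^c}` whenever `f^I ≢ 0`. -/
def IsConvenientSubdivision {n : ℕ} (f : MixedPoly n) (S : Set (Finset (Fin n → ℕ))) : Prop :=
  ∀ I : Finset (Fin n), RestrictionNonzero f I → stdCone Iᶜ ∈ S

/-! ## The toric modification associated with a subdivision -/

/-- The `n`-dimensional cones of `S`. -/
def MaxCone {n : ℕ} (S : Set (Finset (Fin n → ℕ))) : Type :=
  {σ : Finset (Fin n → ℕ) // σ ∈ S ∧ σ.card = n}

/-- The toric chart `ℂⁿ_σ`, with one coordinate for each vertex of `σ`. -/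
abbrev ChartSpace {n : ℕ} {S : Set (Finset (Fin n → ℕ))} (σ : MaxCone S) : Type :=
  {p : Fin n → ℕ // p ∈ σ.1} → ℂ

/-- The toric morphism `π_σ : ℂⁿ_σ → ℂⁿ`, `z_i = ∏_p u_p ^ {p_i}`. -/
def toricMorphism {n : ℕ} {S : Set (Finset (Fin n → ℕ))} (σ : MaxCone S) (u : ChartSpace σ) :
    Fin n → ℂ :=
  fun i => ∏ p, u p ^ p.1 i

/-- Gluing of the charts: `u ∈ ℂⁿ_σ` and `v ∈ ℂⁿ_τ` are identified if the monomial map with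
exponent matrix `l = τ⁻¹σ` is defined at `u` (no vanishing coordinate is raised to a negative
power) and maps `u` to `v`. -/
def Glue {n : ℕ} {S : Set (Finset (Fin n → ℕ))} (x y : Σ σ : MaxCone S, ChartSpace σ) : Prop :=
  ∃ l : {q : Fin n → ℕ // q ∈ y.1.1} → {p : Fin n → ℕ // p ∈ x.1.1} → ℤ,
    (∀ p, ∀ i, (p.1 i : ℤ) = ∑ q, l q p * (q.1 i : ℤ)) ∧
    (∀ p, x.2 p = 0 → ∀ q, 0 ≤ l q p) ∧
    ∀ q, y.2 q = ∏ p, x.2 p ^ l q p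

/-- The toric variety `X` of the subdivision `S`: the disjoint union of the toric charts, modulo
the gluing, with the quotient topology. -/
def ToricSpace {n : ℕ} (S : Set (Finset (Fin n → ℕ))) : Type :=
  Quot (Glue (S := S))

instance {n : ℕ} (S : Set (Finset (Fin n → ℕ))) : TopologicalSpace (ToricSpace S) :=
  inferInstanceAs (TopologicalSpace (Quot (Glue (S := S))))

/-- The inclusion of the toric chart `ℂⁿ_σ` into `X`. -/
def toricChart {n : ℕ} {S : Set (Finset (Fin n → ℕ))} (σ : MaxCone S) (u : ChartSpace σ) :
    ToricSpace S :=
  Quot.mk _ ⟨σ, u⟩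

/-- The toric morphisms are compatible with the gluing. -/
theorem toricMorphism_eq_of_glue {n : ℕ} {S : Set (Finset (Fin n → ℕ))}
    (x y : Σ σ : MaxCone S, ChartSpace σ) (h : Glue x y) :
    toricMorphism x.1 x.2 = toricMorphism y.1 y.2 := by
  obtain ⟨l, h1, h2, h3⟩ := h
  funext i
  have key : ∀ p, x.2 p ^ p.1 i = ∏ q, (x.2 p ^ l q p) ^ q.1 i := by
    intro p
    rw [← zpow_natCast (x.2 p) (p.1 i), h1 p i]
    by_cases h0 : x.2 p = 0
    · have hl : ∀ q, ∃ k : ℕ, l q p = (k : ℤ) := fun q => Int.eq_ofNat_of_zero_le (h2 p h0 q)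
      choose k hk using hl
      have e1 : (∑ q, l q p * (q.1 i : ℤ)) = ((∑ q, k q * q.1 i : ℕ) : ℤ) := by
        push_cast
        exact Finset.sum_congr rfl fun q _ => by rw [hk q]
      rw [e1, zpow_natCast, Finset.prod_pow_eq_pow_sum Finset.univ (fun q => k q * q.1 i) _ |>.symm]
      refine Finset.prod_congr rfl fun q _ => ?_
      rw [hk q, zpow_natCast, pow_mul]
    · have e2 : ∀ s : Finset {q : Fin n → ℕ // q ∈ y.1.1},
          x.2 p ^ (∑ q ∈ s, l q p * (q.1 i : ℤ)) = ∏ q ∈ s, (x.2 p ^ l q p) ^ q.1 i := by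
        intro s
        induction s using Finset.cons_induction with
        | empty => simp
        | cons a s ha ih =>
          rw [Finset.sum_cons, Finset.prod_cons, zpow_add₀ h0, ih, zpow_mul, zpow_natCast]
      exact e2 Finset.univ
  simp only [toricMorphism]
  rw [Finset.prod_congr rfl fun p _ => key p, Finset.prod_comm]
  refine Finset.prod_congr rfl fun q _ => ?_
  rw [h3 q, Finset.prod_pow]

/-- The toric modification `π̂ : X → ℂⁿ`. -/
def toricModification {n : ℕ} (S : Set (Finset (Fin n → ℕ))) : ToricSpace S → (Fin n → ℂ) :=
  Quot.lift (fun x => toricMorphism x.1 x.2) toricMorphism_eq_of_glue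

/-- The divisor `Ê(P)` of `X` defined by the vertex `P`: in each chart containing `P` as a vertex
it is `{u_P = 0}`. -/
def divisor {n : ℕ} (S : Set (Finset (Fin n → ℕ))) (P : Fin n → ℕ) : Set (ToricSpace S) :=
  {x | ∃ (σ : MaxCone S) (u : ChartSpace σ) (hP : P ∈ σ.1), u ⟨P, hP⟩ = 0 ∧ x = toricChart σ u}

/-- The stratum `Ê(τ)^*`. -/
def stratum {n : ℕ} (S : Set (Finset (Fin n → ℕ))) (τ : Finset (Fin n → ℕ)) :
    Set (ToricSpace S) :=
  (⋂ P ∈ τ, divisor S P) \ ⋃ Q ∈ {Q | Q ∈ vertices S ∧ toReal Q ∉ cone τ}, divisor S Q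

/-! ## The strict transform, `L(Σ^*)`, and Assumption (*) -/

/-- The strict transform of `V = f⁻¹(0)`: the closure in `X` of `π̂⁻¹(V ∖ {0})`. -/
def strictTransform {n : ℕ} (f : MixedPoly n) (S : Set (Finset (Fin n → ℕ))) :
    Set (ToricSpace S) :=
  closure (toricModification S ⁻¹' ({z | evalMixed f z = 0} \ {0}))

/-- The part of the strict transform over the origin, `Ṽ ∩ π̂⁻¹(0)`. -/
def strictTransformOverZero {n : ℕ} (f : MixedPoly n) (S : Set (Finset (Fin n → ℕ))) :
    Set (ToricSpace S) :=
  strictTransform f S ∩ toricModification S ⁻¹' {0}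

/-- The numbers `P_j(ν + μ) - d(P_j)` for `c_{ν,μ} ≠ 0`, `P_j` a vertex of `τ`,
`ν + μ ∉ Δ(P_j)`. -/
def excessSet {n : ℕ} (f : MixedPoly n) (τ : Finset (Fin n → ℕ)) : Set ℝ :=
  {x | ∃ ν μ : Fin n → ℕ, ∃ P ∈ τ, f (ν, μ) ≠ 0 ∧ toReal (ν + μ) ∉ face f (toReal P) ∧
    x = pairing (toReal P) (toReal (ν + μ)) - minValue f (toReal P)}

/-- The set `L(Σ^*)` of all the minima `Λ(τ) = min (excessSet f τ)`, where `τ` has only strictly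
positive vertices, `excessSet f τ ≠ ∅`, and the stratum of the strict transform belonging to `τ`
meets the chart of some `n`-dimensional cone `σ` that has `τ` as a face. -/
def lambdaSet {n : ℕ} (f : MixedPoly n) (S : Set (Finset (Fin n → ℕ))) : Set ℝ :=
  {x | ∃ τ ∈ S, (∀ P ∈ τ, StrictlyPositive (toReal P)) ∧ (excessSet f τ).Nonempty ∧
    (∃ σ : MaxCone S, τ ⊆ σ.1 ∧
      (strictTransform f S ∩ stratum S τ ∩ Set.range (toricChart σ)).Nonempty) ∧
    x = sInf (excessSet f τ)}

/-- Assumption (*): each point of `Ṽ ∩ π̂⁻¹(0)` lies in a toric chart `ℂⁿ_σ` in which at least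
one of its coordinates vanishes, and all the vertices of `σ` that belong to vanishing coordinates
are strictly positive. -/
def AssumptionStar {n : ℕ} (f : MixedPoly n) (S : Set (Finset (Fin n → ℕ))) : Prop :=
  ∀ x ∈ strictTransformOverZero f S, ∃ (σ : MaxCone S) (u : ChartSpace σ),
    x = toricChart σ u ∧ (∃ p, u p = 0) ∧ ∀ p, u p = 0 → StrictlyPositive (toReal p.1)

/-! ## Real analytic manifolds -/

/-- Near `x`, the subset `A` of the finite-dimensional real vector space `E` is a real analytic
submanifold of dimension `d`: it is the zero set of a real analytic submersion. -/
def IsAnalyticSubmanifoldAt {E : Type*} [NormedAddCommGroup E] [NormedSpace ℝ E]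
    (A : Set E) (d : ℕ) (x : E) : Prop :=
  ∃ (m : ℕ) (U : Set E) (g : E → (Fin m → ℝ)), m + d = Module.finrank ℝ E ∧ IsOpen U ∧ x ∈ U ∧
    AnalyticOnNhd ℝ g U ∧ Function.Surjective (fderiv ℝ g x) ∧ A ∩ U = {y | y ∈ U ∧ g y = 0}

/-- The germ of `A ⊆ X` along `K` is a real analytic manifold of dimension `d`: for some open
`W ⊇ K`, the set `A ∩ W` is, in each of the toric charts, a real analytic submanifold of
dimension `d` at each of its points. -/
def IsAnalyticManifoldGerm {n : ℕ} {S : Set (Finset (Fin n → ℕ))} (A K : Set (ToricSpace S))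
    (d : ℕ) : Prop :=
  ∃ W : Set (ToricSpace S), IsOpen W ∧ K ⊆ W ∧
    ∀ (σ : MaxCone S) (u : ChartSpace σ), toricChart σ u ∈ A ∩ W →
      IsAnalyticSubmanifoldAt (toricChart σ ⁻¹' A) d u

/-! ## The ordinary blow-up -/

/-- The quotient topology on the complex projective space. -/
instance (n : ℕ) : TopologicalSpace (ℙ ℂ (Fin n → ℂ)) :=
  TopologicalSpace.coinduced (Projectivization.mk' ℂ) inferInstance

/-- The blow-up of `ℂⁿ` at the origin, `{(z, ℓ) ∈ ℂⁿ × ℙ^{n-1} | z ∈ ℓ}`. -/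
def BlowUp (n : ℕ) : Type :=
  {x : (Fin n → ℂ) × ℙ ℂ (Fin n → ℂ) // x.1 ∈ x.2.submodule}

instance (n : ℕ) : TopologicalSpace (BlowUp n) :=
  inferInstanceAs
    (TopologicalSpace {x : (Fin n → ℂ) × ℙ ℂ (Fin n → ℂ) // x.1 ∈ x.2.submodule})

/-- The blow-down map `(z, ℓ) ↦ z`. -/
def blowDown {n : ℕ} (x : BlowUp n) : Fin n → ℂ := x.1.1

theorem update_one_ne_zero {n : ℕ} (i : Fin n) (a : Fin n → ℂ) :
    Function.update a i 1 ≠ 0 := fun h => by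
  have := congrFun h i
  simp at this

/-- The standard affine charts of the blow-up: with `w` obtained from `a` by setting the `i`-th
coordinate to `1`, the point `(a_i w, [w])`. -/
def blowUpChart {n : ℕ} (i : Fin n) (a : Fin n → ℂ) : BlowUp n :=
  ⟨(a i • Function.update a i 1,
    Projectivization.mk ℂ (Function.update a i 1) (update_one_ne_zero i a)), by
    rw [Projectivization.submodule_mk]
    exact Submodule.smul_mem _ _ (Submodule.mem_span_singleton_self _)⟩

/-- The map `φ : X → Y` is holomorphic with respect to the families of chart parametrizations
`α` of `X` and `β` of `Y`. -/
def IsHolomorphicInCharts {ι κ X Y : Type*} {E : ι → Type*} {F : κ → Type*}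
    [∀ i, NormedAddCommGroup (E i)] [∀ i, NormedSpace ℂ (E i)]
    [∀ j, NormedAddCommGroup (F j)] [∀ j, NormedSpace ℂ (F j)]
    (α : ∀ i, E i → X) (β : ∀ j, F j → Y) (φ : X → Y) : Prop :=
  ∀ (i : ι) (u : E i), ∃ (j : κ) (ψ : E i → F j), AnalyticAt ℂ ψ u ∧
    ∀ᶠ u' in 𝓝 u, φ (α i u') = β j (ψ u')

/-- The toric modification of `S` is the ordinary blow-up of the origin: there is a biholomorphic
map `X ≅ BlowUp n` over `ℂⁿ`. -/
def IsOrdinaryBlowUp {n : ℕ} (S : Set (Finset (Fin n → ℕ))) : Prop :=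
  ∃ φ : ToricSpace S ≃ₜ BlowUp n,
    (∀ x, blowDown (φ x) = toricModification S x) ∧
    IsHolomorphicInCharts (fun σ : MaxCone S => toricChart σ)
      (fun i : Fin n => blowUpChart i) φ ∧
    IsHolomorphicInCharts (fun i : Fin n => blowUpChart i)
      (fun σ : MaxCone S => toricChart σ) φ.symm

end

end MixedToric

open MixedToric

/-!
Since all exponents of `f` lie on the line `ξ₀ + ξ₁ = r` and, by convenience, both `(r, 0)` and
`(0, r)` occur, the Newton polyhedron is `{ξ | ξ₀, ξ₁ ≥ 0, ξ₀ + ξ₁ ≥ r}`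
(`newtonPolyhedron_eq_cornerRegion`). Hence the face `Δ(Q)` depends only on the position of `Q`
with respect to the diagonal and the coordinate axes (`face_eq_face_iff`); the statements on faces
and degrees are read off from `mem_face_iff`.

The classes of weight vectors are the relative interiors of the cones spanned by the faces of
`{(1, 1), E₀}` and `{(1, 1), E₁}` (`dualClass_eq_coneInterior`). A regular cone determines its
vertices (`IsRegularCone.eq_of_cone_eq`), so that `dualSubdivision f` is exactly this fan, and two
of its cones meet in a common face because the relative interiors are disjoint.

The chart of `Cone((1, 1), E_j)` has the toric morphism `(s, t) ↦ s • w`, where the `j`-th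
coordinate of `w` is `t` and the other one is `1`: a standard chart of the blow-up. The gluing
relation of the toric charts is the overlap relation of the standard charts (`glue_iff`), and the
standard charts are open embeddings; this gives the biholomorphic map
(`isOrdinaryBlowUp_blowUpFan`).

All terms of `f` have the same degree `a` in the variables and the same degree `b` in their
conjugates, so `f(s • w) = s ^ a * conj s ^ b * f(w)`. In the chart, the strict transform is
therefore the full cylinder `{(s, t) | f(w) = 0}`
(`IsBihomogeneous.toricChart_preimage_strictTransform`). By convenience `t ≠ 0` on it, so Newton
non-degeneracy makes the differential of `f` at `w` surjective. As this differential vanishes on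
`ℂ • w` (Euler's relation, `IsBihomogeneous.fderiv_smul_eq_zero`), the derivative in the direction
of `t` alone is surjective, and the strict transform is smooth everywhere.
-/

namespace MixedToric

/-! ### The Newton polyhedron of a convenient homogeneous polynomial and its faces -/

/-- The region `{x | x₀, x₁ ≥ 0, x₀ + x₁ ≥ r}` of the plane. -/
def cornerRegion (r : ℝ) : Set (Fin 2 → ℝ) := {x | 0 ≤ x 0 ∧ 0 ≤ x 1 ∧ r ≤ x 0 + x 1}

theorem newtonPolyhedron_eq_cornerRegion {f : MixedPoly 2} {r : ℝ} (hr : 0 < r)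
    (hdeg : ∀ ν μ, f (ν, μ) ≠ 0 → toReal (ν + μ) 0 + toReal (ν + μ) 1 = r)
    (hvert : ∀ i, ∃ ν μ, f (ν, μ) ≠ 0 ∧ toReal (ν + μ) = Pi.single i r) :
    newtonPolyhedron f = cornerRegion r := by
  apply Set.Subset.antisymm
  · refine convexHull_min ?_ ?_
    · rintro x ⟨ν, μ, hf, hx⟩
      have h0 := hx 0
      have h1 := hx 1
      have hd := hdeg ν μ hf
      have p0 : 0 ≤ toReal (ν + μ) 0 := Nat.cast_nonneg _
      have p1 : 0 ≤ toReal (ν + μ) 1 := Nat.cast_nonneg _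
      exact ⟨by linarith, by linarith, by linarith⟩
    · rintro x ⟨hx0, hx1, hx⟩ y ⟨hy0, hy1, hy⟩ a b ha hb hab
      refine ⟨?_, ?_, ?_⟩
      · simp only [Pi.add_apply, Pi.smul_apply, smul_eq_mul]; positivity
      · simp only [Pi.add_apply, Pi.smul_apply, smul_eq_mul]; positivity
      · simp only [Pi.add_apply, Pi.smul_apply, smul_eq_mul]
        have e : r = a * r + b * r := by rw [← add_mul, hab, one_mul]
        nlinarith [mul_le_mul_of_nonneg_left hx ha, mul_le_mul_of_nonneg_left hy hb]
  · rintro x ⟨hx0, hx1, hx⟩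
    -- `x` lies on the segment between the points of the axes with the same coordinate sum
    have hs : 0 < x 0 + x 1 := by linarith
    have key : ∀ i, Pi.single i (x 0 + x 1) ∈ newtonPolyhedron f := by
      intro i
      obtain ⟨ν, μ, hf, hm⟩ := hvert i
      refine subset_convexHull ℝ _ ⟨ν, μ, hf, fun j => ?_⟩
      rw [hm]
      exact (Pi.single_mono (f := fun _ : Fin 2 => ℝ) i) hx j
    have hx' : x = (x 0 / (x 0 + x 1)) • Pi.single 0 (x 0 + x 1)
        + (x 1 / (x 0 + x 1)) • Pi.single 1 (x 0 + x 1) := by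
      funext j
      fin_cases j <;> simp [hs.ne']
    rw [hx']
    refine (convex_convexHull ℝ _) (key 0) (key 1) (by positivity) (by positivity) ?_
    field_simp

theorem minValue_eq_mul_min {f : MixedPoly 2} {r : ℝ} (hr : 0 < r)
    (hΓ : newtonPolyhedron f = cornerRegion r) {Q : Fin 2 → ℝ} (hQ : Q ∈ weightCone 2) :
    minValue f Q = r * min (Q 0) (Q 1) := by
  refine IsLeast.csInf_eq ⟨?_, ?_⟩
  · rw [hΓ]
    rcases le_total (Q 0) (Q 1) with h | h
    · exact ⟨Pi.single 0 r, by simp [cornerRegion, hr.le], by simp [pairing, h, mul_comm]⟩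
    · exact ⟨Pi.single 1 r, by simp [cornerRegion, hr.le], by simp [pairing, h, mul_comm]⟩
  · rintro _ ⟨x, hx, rfl⟩
    rw [hΓ] at hx
    obtain ⟨h0, h1, h⟩ := hx
    simp only [pairing, Fin.sum_univ_two]
    have hm : 0 ≤ min (Q 0) (Q 1) := le_min (hQ 0) (hQ 1)
    nlinarith [mul_le_mul_of_nonneg_right (min_le_left (Q 0) (Q 1)) h0,
      mul_le_mul_of_nonneg_right (min_le_right (Q 0) (Q 1)) h1, mul_le_mul_of_nonneg_left h hm]

/-- With `m = min Q`, the excess `Q(x) - d(Q)` is the sum of the three nonnegative terms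
`(Q₀ - m) x₀`, `(Q₁ - m) x₁` and `m (x₀ + x₁ - r)`, each of which has to vanish on the face. -/
theorem mem_face_iff {f : MixedPoly 2} {r : ℝ} (hr : 0 < r)
    (hΓ : newtonPolyhedron f = cornerRegion r) {Q : Fin 2 → ℝ} (hQ : Q ∈ weightCone 2)
    {x : Fin 2 → ℝ} :
    x ∈ face f Q ↔ x ∈ cornerRegion r ∧ (Q 0 ≤ Q 1 ∨ x 0 = 0) ∧ (Q 1 ≤ Q 0 ∨ x 1 = 0) ∧
      (Q 0 = 0 ∨ Q 1 = 0 ∨ x 0 + x 1 = r) := by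
  have hQ0 := hQ 0
  have hQ1 := hQ 1
  simp only [face, Set.mem_ofPred_eq, hΓ, minValue_eq_mul_min hr hΓ hQ, pairing, Fin.sum_univ_two]
  refine and_congr_right ?_
  rintro ⟨h0, h1, h⟩
  have h' : 0 ≤ x 0 + x 1 - r := by linarith
  rcases lt_trichotomy (Q 0) (Q 1) with hlt | heq | hlt
  · rw [min_eq_left hlt.le]
    have e : Q 0 * x 0 + Q 1 * x 1 = r * Q 0 ↔
        (Q 1 - Q 0) * x 1 + Q 0 * (x 0 + x 1 - r) = 0 := by
      constructor <;> intro h <;> linarith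
    rw [e, add_eq_zero_iff_of_nonneg (mul_nonneg (by linarith) h1) (mul_nonneg hQ0 h')]
    have : Q 1 ≠ 0 := by linarith
    simp [hlt.le, hlt.not_ge, this, sub_eq_zero, hlt.ne']
  · rw [heq, min_self]
    have e : Q 1 * x 0 + Q 1 * x 1 = r * Q 1 ↔ Q 1 * (x 0 + x 1 - r) = 0 := by
      constructor <;> intro h <;> linarith
    rw [e]
    simp [sub_eq_zero]
  · rw [min_eq_right hlt.le]
    have e : Q 0 * x 0 + Q 1 * x 1 = r * Q 1 ↔
        (Q 0 - Q 1) * x 0 + Q 1 * (x 0 + x 1 - r) = 0 := by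
      constructor <;> intro h <;> linarith
    rw [e, add_eq_zero_iff_of_nonneg (mul_nonneg (by linarith) h0) (mul_nonneg hQ1 h')]
    have : Q 0 ≠ 0 := by linarith
    simp [hlt.le, hlt.not_ge, this, sub_eq_zero, hlt.ne']

/-- Two weight vectors of the plane have the same position with respect to the diagonal and the
two coordinate axes. -/
def SamePosition (Q Q' : Fin 2 → ℝ) : Prop :=
  (Q 0 ≤ Q 1 ↔ Q' 0 ≤ Q' 1) ∧ (Q 1 ≤ Q 0 ↔ Q' 1 ≤ Q' 0) ∧ (Q 0 = 0 ↔ Q' 0 = 0) ∧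
    (Q 1 = 0 ↔ Q' 1 = 0)

/-- The positions can be read off from the points `(r, 0)`, `(0, r)`, `(r + 1, 0)` and
`(0, r + 1)`. -/
theorem face_eq_face_iff {f : MixedPoly 2} {r : ℝ} (hr : 0 < r)
    (hΓ : newtonPolyhedron f = cornerRegion r) {Q Q' : Fin 2 → ℝ} (hQ : Q ∈ weightCone 2)
    (hQ' : Q' ∈ weightCone 2) :
    face f Q = face f Q' ↔ SamePosition Q Q' := by
  constructor
  · intro h
    have test : ∀ x, x ∈ face f Q ↔ x ∈ face f Q' := fun x => by rw [h]
    have hr1 : r + 1 ≠ 0 := by linarith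
    have hr2 : 0 ≤ r + 1 := by linarith
    have t0 := test (Pi.single 0 r)
    have t1 := test (Pi.single 1 r)
    have t2 := test (Pi.single 0 (r + 1))
    have t3 := test (Pi.single 1 (r + 1))
    simp only [mem_face_iff hr hΓ hQ, mem_face_iff hr hΓ hQ'] at t0 t1 t2 t3
    simp [cornerRegion, hr.le, hr.ne', hr1, hr2] at t0 t1 t2 t3
    have a0 := hQ 0
    have a1 := hQ 1
    have b0 := hQ' 0
    have b1 := hQ' 1
    refine ⟨t0, t1, ?_, ?_⟩
    · constructor
      · intro h0
        have := t2.1 ⟨by linarith, Or.inl h0⟩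
        rcases this.2 with h | h
        · exact h
        · linarith [this.1]
      · intro h0
        have := t2.2 ⟨by linarith, Or.inl h0⟩
        rcases this.2 with h | h
        · exact h
        · linarith [this.1]
    · constructor
      · intro h0
        have := t3.1 ⟨by linarith, Or.inr h0⟩
        rcases this.2 with h | h
        · linarith [this.1]
        · exact h
      · intro h0
        have := t3.2 ⟨by linarith, Or.inr h0⟩
        rcases this.2 with h | h
        · linarith [this.1]
        · exact h
  · rintro ⟨h1, h2, h3, h4⟩
    ext x
    rw [mem_face_iff hr hΓ hQ, mem_face_iff hr hΓ hQ', h1, h2, h3, h4]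

theorem dualClass_eq {f : MixedPoly 2} {r : ℝ} (hr : 0 < r)
    (hΓ : newtonPolyhedron f = cornerRegion r) {Q : Fin 2 → ℝ} (hQ : Q ∈ weightCone 2) :
    dualClass f Q = {Q' | Q' ∈ weightCone 2 ∧ SamePosition Q' Q} := by
  ext Q'
  exact and_congr_right fun h => face_eq_face_iff hr hΓ h hQ

theorem face_one {f : MixedPoly 2} {r : ℝ} (hr : 0 < r)
    (hΓ : newtonPolyhedron f = cornerRegion r) :
    face f (fun _ => 1) = {x | 0 ≤ x 0 ∧ 0 ≤ x 1 ∧ x 0 + x 1 = r} := by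
  ext x
  rw [mem_face_iff hr hΓ (fun _ => zero_le_one)]
  simp only [cornerRegion, Set.mem_ofPred_eq, le_refl, true_or, one_ne_zero, false_or, true_and]
  constructor
  · rintro ⟨⟨h0, h1, -⟩, h⟩; exact ⟨h0, h1, h⟩
  · rintro ⟨h0, h1, h⟩; exact ⟨⟨h0, h1, h.ge⟩, h⟩

theorem StrictlyPositive.ne_zero {Q : Fin 2 → ℝ} (hQ : StrictlyPositive Q) : Q ≠ 0 := by
  rintro rfl
  exact lt_irrefl _ (hQ 0)

theorem strictlyPositive_one_add_stdVec (i : Fin 2) :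
    StrictlyPositive ((fun _ => 1 : Fin 2 → ℝ) + toReal (stdVec i)) := fun j => by
  simp only [Pi.add_apply, toReal]; positivity

theorem one_add_stdVec_mem_weightCone (i : Fin 2) :
    (fun _ => 1 : Fin 2 → ℝ) + toReal (stdVec i) ∈ weightCone 2 :=
  fun j => (strictlyPositive_one_add_stdVec i j).le

theorem face_one_add_stdVec {f : MixedPoly 2} {r : ℝ} (hr : 0 < r)
    (hΓ : newtonPolyhedron f = cornerRegion r) (i : Fin 2) :
    face f ((fun _ => 1) + toReal (stdVec i)) = {Pi.single i.rev r} := by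
  ext x
  rw [mem_face_iff hr hΓ (one_add_stdVec_mem_weightCone i)]
  simp only [Set.mem_singleton_iff, funext_iff, Fin.forall_fin_two]
  fin_cases i
  · simp [cornerRegion, toReal, stdVec]
    norm_num
    constructor
    · rintro ⟨⟨h0, h1, -⟩, h, h'⟩; exact ⟨h, by linarith⟩
    · rintro ⟨h0, h1⟩; rw [h0, h1]; simp [hr.le]
  · simp [cornerRegion, toReal, stdVec]
    norm_num
    constructor
    · rintro ⟨⟨h0, h1, -⟩, h, h'⟩; exact ⟨by linarith, h⟩
    · rintro ⟨h0, h1⟩; rw [h0, h1]; simp [hr.le]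

theorem hasDim_singleton {n : ℕ} (x : Fin n → ℝ) : HasDim {x} 0 :=
  ⟨Set.singleton_nonempty x, by rw [vectorSpan_singleton, finrank_bot]⟩

theorem hasDim_face_one {f : MixedPoly 2} {r : ℝ} (hr : 0 < r)
    (hΓ : newtonPolyhedron f = cornerRegion r) : HasDim (face f (fun _ => 1)) 1 := by
  rw [face_one hr hΓ]
  have m0 : Pi.single 0 r ∈ {x : Fin 2 → ℝ | 0 ≤ x 0 ∧ 0 ≤ x 1 ∧ x 0 + x 1 = r} := by
    simp [hr.le]
  have m1 : Pi.single 1 r ∈ {x : Fin 2 → ℝ | 0 ≤ x 0 ∧ 0 ≤ x 1 ∧ x 0 + x 1 = r} := by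
    simp [hr.le]
  refine ⟨⟨_, m0⟩, ?_⟩
  have hspan : vectorSpan ℝ {x : Fin 2 → ℝ | 0 ≤ x 0 ∧ 0 ≤ x 1 ∧ x 0 + x 1 = r} =
      Submodule.span ℝ {(Pi.single 0 r - Pi.single 1 r : Fin 2 → ℝ)} := by
    apply le_antisymm
    · rw [vectorSpan_def, Submodule.span_le]
      rintro _ ⟨x, ⟨-, -, hx⟩, y, ⟨-, -, hy⟩, rfl⟩
      refine Submodule.mem_span_singleton.2 ⟨(x 0 - y 0) / r, ?_⟩
      funext j
      fin_cases j
      · simp [hr.ne']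
      · simp [hr.ne']; linarith
    · rw [Submodule.span_le, Set.singleton_subset_iff]
      exact vsub_mem_vectorSpan ℝ m0 m1
  rw [hspan, finrank_span_singleton]
  intro h
  have := congrFun h 0
  simp [hr.ne'] at this

theorem isCompact_face_of_pos {f : MixedPoly 2} {r : ℝ} (hr : 0 < r)
    (hΓ : newtonPolyhedron f = cornerRegion r) {Q : Fin 2 → ℝ} (hQ : StrictlyPositive Q) :
    IsCompact (face f Q) := by
  have hQ' : Q ∈ weightCone 2 := fun i => (hQ i).le
  refine (isCompact_Icc (a := (0 : Fin 2 → ℝ)) (b := fun _ => r)).of_isClosed_subset ?_ ?_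
  · have : face f Q = {x | 0 ≤ x 0 ∧ 0 ≤ x 1 ∧ r ≤ x 0 + x 1 ∧
        Q 0 * x 0 + Q 1 * x 1 = minValue f Q} := by
      ext x
      simp [face, hΓ, cornerRegion, pairing, and_assoc]
    rw [this]
    have c0 : IsClosed {x : Fin 2 → ℝ | 0 ≤ x 0} := isClosed_le (by fun_prop) (by fun_prop)
    have c1 : IsClosed {x : Fin 2 → ℝ | 0 ≤ x 1} := isClosed_le (by fun_prop) (by fun_prop)
    have c2 : IsClosed {x : Fin 2 → ℝ | r ≤ x 0 + x 1} :=
      isClosed_le (by fun_prop) (by fun_prop)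
    have c3 : IsClosed {x : Fin 2 → ℝ | Q 0 * x 0 + Q 1 * x 1 = minValue f Q} :=
      isClosed_eq (by fun_prop) (by fun_prop)
    exact c0.inter (c1.inter (c2.inter c3))
  · intro x hx
    rw [mem_face_iff hr hΓ hQ'] at hx
    obtain ⟨⟨h0, h1, -⟩, -, -, h⟩ := hx
    simp only [(hQ 0).ne', (hQ 1).ne', false_or] at h
    constructor <;> intro j <;> fin_cases j <;> simp <;> linarith

theorem not_isCompact_face_of_eq_zero {f : MixedPoly 2} {r : ℝ} (hr : 0 < r)
    (hΓ : newtonPolyhedron f = cornerRegion r) {Q : Fin 2 → ℝ} (hQ : Q ∈ weightCone 2)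
    {i : Fin 2} (hi : Q i = 0) : ¬ IsCompact (face f Q) := by
  intro hc
  obtain ⟨C, hC⟩ := (hc.image (continuous_apply i)).bddAbove
  -- the whole ray of the `i`-th axis from `r` on belongs to the face
  have hmem : Pi.single i (max r (C + 1)) ∈ face f Q := by
    have hm : 0 ≤ max r (C + 1) := hr.le.trans (le_max_left _ _)
    rw [mem_face_iff hr hΓ hQ]
    have h0 := hQ 0
    have h1 := hQ 1
    fin_cases i
    · simp at hi
      simp [cornerRegion, hi, h1, hm]
    · simp at hi
      simp [cornerRegion, hi, h0, hm]
  have := hC ⟨_, hmem, rfl⟩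
  have h1 := le_max_right r (C + 1)
  simp only [Pi.single_eq_same] at this
  linarith

theorem setOf_isCompactFace_eq {f : MixedPoly 2} {r : ℝ} (hr : 0 < r)
    (hΓ : newtonPolyhedron f = cornerRegion r) :
    {Δ | IsCompactFace f Δ} = {face f (fun _ => 1),
      face f ((fun _ => 1) + toReal (stdVec 0)), face f ((fun _ => 1) + toReal (stdVec 1))} := by
  have hw := one_add_stdVec_mem_weightCone
  have hone : (fun _ => 1 : Fin 2 → ℝ) ∈ weightCone 2 := fun _ => zero_le_one
  have hpos := strictlyPositive_one_add_stdVec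
  have hone' : StrictlyPositive (fun _ => 1 : Fin 2 → ℝ) := fun _ => zero_lt_one
  ext Δ
  simp only [Set.mem_ofPred_eq, Set.mem_insert_iff, Set.mem_singleton_iff]
  constructor
  · rintro ⟨hc, Q, hQ, -, rfl⟩
    have h0 : Q 0 ≠ 0 := fun h => not_isCompact_face_of_eq_zero hr hΓ hQ h hc
    have h1 : Q 1 ≠ 0 := fun h => not_isCompact_face_of_eq_zero hr hΓ hQ h hc
    rw [face_eq_face_iff hr hΓ hQ hone, face_eq_face_iff hr hΓ hQ (hw 0),
      face_eq_face_iff hr hΓ hQ (hw 1)]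
    rcases lt_trichotomy (Q 0) (Q 1) with h | h | h
    · right; right
      simp [SamePosition, toReal, stdVec, h0, h1, h.le, h.not_ge]
    · left
      simp [SamePosition, h1, h]
    · right; left
      simp [SamePosition, toReal, stdVec, h0, h1, h.le, h.not_ge]
  · rintro (rfl | rfl | rfl)
    · exact ⟨isCompact_face_of_pos hr hΓ hone', _, hone, hone'.ne_zero, rfl⟩
    · exact ⟨isCompact_face_of_pos hr hΓ (hpos 0), _, hw 0, (hpos 0).ne_zero, rfl⟩
    · exact ⟨isCompact_face_of_pos hr hΓ (hpos 1), _, hw 1, (hpos 1).ne_zero, rfl⟩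

/-! ### Regular cones -/

theorem coneInterior_subset_cone {n : ℕ} (τ : Finset (Fin n → ℕ)) : coneInterior τ ⊆ cone τ := by
  rintro x ⟨r, hr, rfl⟩
  exact ⟨r, fun p hp => (hr p hp).le, rfl⟩

theorem cone_mono {n : ℕ} {ρ τ : Finset (Fin n → ℕ)} (h : ρ ⊆ τ) : cone ρ ⊆ cone τ := by
  classical
  rintro x ⟨r, hr, rfl⟩
  refine ⟨fun p => if p ∈ ρ then r p else 0, fun p _ => ?_, ?_⟩
  · dsimp only
    split_ifs with hp
    exacts [hr p hp, le_rfl]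
  · refine Finset.sum_subset_zero_on_sdiff h (fun p hp => ?_) fun p hp => ?_
    · simp [(Finset.mem_sdiff.1 hp).2]
    · simp [hp]

theorem mem_cone_iff_exists_subset {n : ℕ} {τ : Finset (Fin n → ℕ)} {x : Fin n → ℝ} :
    x ∈ cone τ ↔ ∃ ρ ⊆ τ, x ∈ coneInterior ρ := by
  classical
  constructor
  · rintro ⟨r, hr, rfl⟩
    refine ⟨τ.filter fun p => r p ≠ 0, Finset.filter_subset _ _, r, fun p hp => ?_, ?_⟩
    · rw [Finset.mem_filter] at hp
      exact lt_of_le_of_ne (hr p hp.1) hp.2.symm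
    · refine (Finset.sum_subset (Finset.filter_subset _ _) fun p hp hp' => ?_).symm
      have : r p = 0 := by simpa [hp] using hp'
      rw [this, zero_smul]
  · rintro ⟨ρ, hρ, hx⟩
    exact cone_mono hρ (coneInterior_subset_cone ρ hx)

theorem cone_subset_closure_coneInterior {n : ℕ} (τ : Finset (Fin n → ℕ)) :
    cone τ ⊆ closure (coneInterior τ) := by
  rintro x ⟨r, hr, rfl⟩
  have hc : Continuous fun t : ℝ => ∑ p ∈ τ, (r p + t) • toReal p := by fun_prop
  have h0 : (0 : ℝ) ∈ closure (Set.Ioi (0 : ℝ)) := by simp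
  have := image_closure_subset_closure_image hc ⟨0, h0, rfl⟩
  simp only [add_zero] at this
  refine closure_mono ?_ this
  rintro _ ⟨t, ht, rfl⟩
  exact ⟨fun p => r p + t, fun p hp => add_pos_of_nonneg_of_pos (hr p hp) ht, rfl⟩

theorem sum_toReal_mem_coneInterior {n : ℕ} (τ : Finset (Fin n → ℕ)) :
    ∑ p ∈ τ, toReal p ∈ coneInterior τ :=
  ⟨fun _ => 1, fun _ _ => zero_lt_one, by simp⟩

theorem IsRegularCone.subset {n : ℕ} {ρ τ : Finset (Fin n → ℕ)} (hτ : IsRegularCone τ)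
    (h : ρ ⊆ τ) : IsRegularCone ρ := by
  obtain ⟨b, hb⟩ := hτ
  exact ⟨b, fun p hp => hb p (h hp)⟩

/-- A vertex of a regular cone is separated from the others by an element of the dual basis. -/
theorem IsRegularCone.exists_dual {n : ℕ} {τ : Finset (Fin n → ℕ)} (hτ : IsRegularCone τ)
    {p : Fin n → ℕ} (hp : p ∈ τ) :
    ∃ c : Fin n → ℤ, ∑ k, c k * (p k : ℤ) = 1 ∧
      ∀ q ∈ τ, q ≠ p → ∑ k, c k * (q k : ℤ) = 0 := by
  obtain ⟨b, hb⟩ := hτ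
  obtain ⟨i, hi⟩ := hb p hp
  have hc : ∀ y : Fin n → ℤ, ∑ k, b.coord i (Pi.single k 1) * y k = b.coord i y := by
    intro y
    conv_rhs => rw [pi_eq_sum_univ' y, map_sum]
    exact Finset.sum_congr rfl fun k _ => by rw [map_smul, smul_eq_mul, mul_comm]
  refine ⟨fun k => b.coord i (Pi.single k 1), ?_, fun q hq hqp => ?_⟩
  · rw [hc fun k => (p k : ℤ), ← hi]; simp
  · obtain ⟨j, hj⟩ := hb q hq
    have hij : j ≠ i := by
      rintro rfl
      apply hqp
      funext k
      have := congrFun (hj.symm.trans hi) k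
      exact_mod_cast this
    rw [hc fun k => (q k : ℤ), ← hj]
    simp [hij]

theorem sum_intCast_mul_toReal {n : ℕ} (c : Fin n → ℤ) (p : Fin n → ℕ) :
    ∑ k, (c k : ℝ) * toReal p k = ((∑ k, c k * (p k : ℤ) : ℤ) : ℝ) := by
  simp [toReal]

theorem sum_mul_sum_smul {n : ℕ} (c : Fin n → ℝ) (τ : Finset (Fin n → ℕ))
    (r : (Fin n → ℕ) → ℝ) :
    ∑ k, c k * (∑ p ∈ τ, r p • toReal p) k = ∑ p ∈ τ, r p * ∑ k, c k * toReal p k := by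
  simp only [Finset.sum_apply, Pi.smul_apply, smul_eq_mul, Finset.mul_sum]
  rw [Finset.sum_comm]
  exact Finset.sum_congr rfl fun p _ => Finset.sum_congr rfl fun k _ => by ring

theorem toReal_mem_cone {n : ℕ} {τ : Finset (Fin n → ℕ)} {p : Fin n → ℕ} (hp : p ∈ τ) :
    toReal p ∈ cone τ := by
  classical
  exact ⟨fun q => if q = p then 1 else 0, fun q _ => by dsimp only; split_ifs <;> simp,
    by simp [hp]⟩

/-- The coefficients of an element of a regular cone are the values of the dual functionals. -/
theorem IsRegularCone.dual_apply {n : ℕ} {τ : Finset (Fin n → ℕ)} {p : Fin n → ℕ} (hp : p ∈ τ)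
    {c : Fin n → ℤ} (h1 : ∑ k, c k * (p k : ℤ) = 1)
    (h0 : ∀ q ∈ τ, q ≠ p → ∑ k, c k * (q k : ℤ) = 0) (r : (Fin n → ℕ) → ℝ) :
    ∑ k, (c k : ℝ) * (∑ q ∈ τ, r q • toReal q) k = r p := by
  rw [sum_mul_sum_smul, Finset.sum_eq_single p]
  · rw [sum_intCast_mul_toReal, h1]; simp
  · intro q hq hqp
    rw [sum_intCast_mul_toReal, h0 q hq hqp]; simp
  · exact fun h => (h hp).elim

/-- The vertices of a regular cone are the primitive vectors on its extremal rays. -/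
theorem IsRegularCone.subset_of_cone_eq {n : ℕ} {τ τ' : Finset (Fin n → ℕ)}
    (hτ : IsRegularCone τ) (hτ' : IsRegularCone τ') (h : cone τ = cone τ') : τ ⊆ τ' := by
  intro p hp
  obtain ⟨c, hc1, hc0⟩ := hτ.exists_dual hp
  have hmem : toReal p ∈ cone τ' := h ▸ toReal_mem_cone hp
  obtain ⟨r, hr, hpr⟩ := hmem
  -- a vertex `q` of `τ'` that occurs in `p` and on which the functional dual to `p` is positive
  obtain ⟨q, hq, hrq⟩ : ∃ q ∈ τ', 0 < r q * ∑ k, (c k : ℝ) * toReal q k := by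
    by_contra! hcon
    have h1 : ∑ k, (c k : ℝ) * toReal p k = 1 := by rw [sum_intCast_mul_toReal, hc1]; simp
    rw [hpr, sum_mul_sum_smul] at h1
    linarith [Finset.sum_nonpos hcon]
  have hrq0 : 0 < r q := lt_of_le_of_ne (hr q hq) fun h => by simp [← h] at hrq
  obtain ⟨s, hs, hqs⟩ : toReal q ∈ cone τ := h ▸ toReal_mem_cone hq
  -- `q` is a multiple of `p`, as the other dual functionals vanish on `p`
  have hs0 : ∀ p' ∈ τ, p' ≠ p → s p' = 0 := by
    intro p' hp' hne
    obtain ⟨c', hc1', hc0'⟩ := hτ.exists_dual hp'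
    have hnonneg : ∀ q' ∈ τ', 0 ≤ r q' * ∑ k, (c' k : ℝ) * toReal q' k := by
      intro q' hq'
      obtain ⟨t, ht, hqt⟩ : toReal q' ∈ cone τ := h ▸ toReal_mem_cone hq'
      rw [hqt, IsRegularCone.dual_apply hp' hc1' hc0']
      exact mul_nonneg (hr q' hq') (ht p' hp')
    have hsum : ∑ q' ∈ τ', r q' * ∑ k, (c' k : ℝ) * toReal q' k = 0 := by
      rw [← sum_mul_sum_smul, ← hpr, sum_intCast_mul_toReal, hc0' p hp hne.symm]; simp
    have := (Finset.sum_eq_zero_iff_of_nonneg hnonneg).1 hsum q hq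
    rw [hqs, IsRegularCone.dual_apply hp' hc1' hc0'] at this
    exact (mul_eq_zero.1 this).resolve_left hrq0.ne'
  have hqp : toReal q = s p • toReal p := by
    rw [hqs, Finset.sum_eq_single p]
    · intro p' hp' hne
      rw [hs0 p' hp' hne, zero_smul]
    · exact fun h => (h hp).elim
  -- both are primitive, so the multiple is `1`
  obtain ⟨d, hd1, -⟩ := hτ'.exists_dual hq
  have e1 : ((∑ k, c k * (q k : ℤ) : ℤ) : ℝ) = s p := by
    rw [← sum_intCast_mul_toReal, hqp]
    simp only [Pi.smul_apply, smul_eq_mul, mul_left_comm _ (s p)]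
    rw [← Finset.mul_sum, sum_intCast_mul_toReal, hc1]; simp
  have e2 : (1 : ℝ) = s p * ((∑ k, d k * (p k : ℤ) : ℤ) : ℝ) := by
    have : ∑ k, (d k : ℝ) * toReal q k = 1 := by rw [sum_intCast_mul_toReal, hd1]; simp
    rw [← this, hqp]
    simp only [Pi.smul_apply, smul_eq_mul, mul_left_comm _ (s p)]
    rw [← Finset.mul_sum, sum_intCast_mul_toReal]
  rw [← e1] at e2
  have e3 : (1 : ℤ) = (∑ k, c k * (q k : ℤ)) * ∑ k, d k * (p k : ℤ) := by exact_mod_cast e2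
  have e4 : (0 : ℤ) ≤ ∑ k, c k * (q k : ℤ) := by
    have := hs p hp
    rw [← e1] at this
    exact_mod_cast this
  have e5 : ∑ k, c k * (q k : ℤ) = 1 := Int.eq_one_of_mul_eq_one_right e4 e3.symm
  rw [e5, Int.cast_one] at e1
  have : q = p := by
    funext k
    have := congrFun hqp k
    rw [← e1, one_smul] at this
    exact Nat.cast_injective this
  exact this ▸ hq

theorem IsRegularCone.eq_of_cone_eq {n : ℕ} {τ τ' : Finset (Fin n → ℕ)}
    (hτ : IsRegularCone τ) (hτ' : IsRegularCone τ') (h : cone τ = cone τ') : τ = τ' :=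
  (hτ.subset_of_cone_eq hτ' h).antisymm (hτ'.subset_of_cone_eq hτ h.symm)

theorem IsRegularCone.isClosed_cone {n : ℕ} {τ : Finset (Fin n → ℕ)} (hτ : IsRegularCone τ) :
    IsClosed (cone τ) := by
  have hd := fun p : τ => hτ.exists_dual p.2
  choose c hc1 hc0 using hd
  -- the cone is cut out by linear equations and inequalities in terms of the dual functionals
  have hcone : cone τ = {x | (∀ p : τ, 0 ≤ ∑ k, (c p k : ℝ) * x k) ∧
      x = ∑ p : τ, (∑ k, (c p k : ℝ) * x k) • toReal p.1} := by
    ext x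
    constructor
    · rintro ⟨r, hr, hx⟩
      have hrp : ∀ p : τ, ∑ k, (c p k : ℝ) * x k = r p := fun p => by
        rw [hx]; exact IsRegularCone.dual_apply p.2 (hc1 p) (hc0 p) r
      refine ⟨fun p => (hrp p).symm ▸ hr p p.2, ?_⟩
      simp only [hrp]
      rw [hx]
      exact (Finset.sum_coe_sort τ fun p => r p • toReal p).symm
    · rintro ⟨h1, h2⟩
      classical
      refine ⟨fun p => if hp : p ∈ τ then ∑ k, (c ⟨p, hp⟩ k : ℝ) * x k else 0,
        fun p hp => ?_, ?_⟩
      · simpa [hp] using h1 ⟨p, hp⟩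
      · conv_lhs => rw [h2]
        rw [← Finset.sum_coe_sort τ]
        exact Finset.sum_congr rfl fun p _ => by simp
  rw [hcone]
  have c1 : IsClosed {x : Fin n → ℝ | ∀ p : τ, 0 ≤ ∑ k, (c p k : ℝ) * x k} := by
    simp only [Set.ofPred_forall]
    exact isClosed_iInter fun p => isClosed_le (by fun_prop) (by fun_prop)
  have c2 : IsClosed {x : Fin n → ℝ | x = ∑ p : τ, (∑ k, (c p k : ℝ) * x k) • toReal p.1} :=
    isClosed_eq (by fun_prop) (by fun_prop)
  exact c1.inter c2

theorem IsRegularCone.closure_coneInterior {n : ℕ} {τ : Finset (Fin n → ℕ)}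
    (hτ : IsRegularCone τ) : closure (coneInterior τ) = cone τ :=
  (closure_minimal (coneInterior_subset_cone τ) hτ.isClosed_cone).antisymm
    (cone_subset_closure_coneInterior τ)

theorem mem_coneInterior_singleton {n : ℕ} {p : Fin n → ℕ} {x : Fin n → ℝ} :
    x ∈ coneInterior {p} ↔ ∃ t : ℝ, 0 < t ∧ x = t • toReal p := by
  constructor
  · rintro ⟨r, hr, rfl⟩
    exact ⟨r p, hr p (Finset.mem_singleton_self p), by simp⟩
  · rintro ⟨t, ht, rfl⟩
    exact ⟨fun _ => t, fun _ _ => ht, by simp⟩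

theorem mem_coneInterior_pair {n : ℕ} {p q : Fin n → ℕ} (hpq : p ≠ q) {x : Fin n → ℝ} :
    x ∈ coneInterior {p, q} ↔
      ∃ s t : ℝ, 0 < s ∧ 0 < t ∧ x = s • toReal p + t • toReal q := by
  classical
  constructor
  · rintro ⟨r, hr, rfl⟩
    exact ⟨r p, r q, hr p (by simp), hr q (by simp), by rw [Finset.sum_pair hpq]⟩
  · rintro ⟨s, t, hs, ht, rfl⟩
    refine ⟨fun a => if a = p then s else t, fun a _ => ?_, ?_⟩
    · dsimp only
      split_ifs <;> assumption
    · rw [Finset.sum_pair hpq]; simp [hpq.symm]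

/-! ### The fan of the blow-up of the plane -/

/-- The fan of the blow-up of the plane: the faces of the two cones spanned by `(1, 1)` and one of
the standard basis vectors. -/
def blowUpFan : Finset (Finset (Fin 2 → ℕ)) :=
  {∅, {fun _ => 1}, {stdVec 0}, {stdVec 1}, {fun _ => 1, stdVec 0}, {fun _ => 1, stdVec 1}}

theorem mem_blowUpFan {τ : Finset (Fin 2 → ℕ)} : τ ∈ blowUpFan ↔
    τ = ∅ ∨ τ = {fun _ => 1} ∨ τ = {stdVec 0} ∨ τ = {stdVec 1} ∨
      τ = {fun _ => 1, stdVec 0} ∨ τ = {fun _ => 1, stdVec 1} := by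
  simp [blowUpFan]

theorem one_ne_stdVec (i : Fin 2) : (fun _ => 1 : Fin 2 → ℕ) ≠ stdVec i := by
  fin_cases i <;> decide

theorem blowUpFan_face_mem {τ ρ : Finset (Fin 2 → ℕ)} (hτ : τ ∈ blowUpFan) (h : ρ ⊆ τ) :
    ρ ∈ blowUpFan := by
  have : ∀ τ ∈ blowUpFan, ∀ ρ ∈ τ.powerset, ρ ∈ blowUpFan := by decide
  exact this τ hτ ρ (Finset.mem_powerset.2 h)

theorem stdCone_compl_mem_blowUpFan {I : Finset (Fin 2)} (hI : I.Nonempty) :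
    stdCone Iᶜ ∈ blowUpFan := by
  revert I; decide

theorem isRegularCone_one_stdVec (i : Fin 2) :
    IsRegularCone {(fun _ => 1 : Fin 2 → ℕ), stdVec i} := by
  let e : (Fin 2 → ℤ) ≃ₗ[ℤ] (Fin 2 → ℤ) :=
    { toFun := fun y => ![y i.rev, y i - y i.rev]
      invFun := fun c k => c 0 + c 1 * (stdVec i k : ℕ)
      map_add' := fun x y => by
        funext k; fin_cases k
        · simp
        · simp; ring
      map_smul' := fun a x => by
        funext k; fin_cases k
        · simp
        · simp; ring
      left_inv := fun y => by
        funext k; fin_cases i <;> fin_cases k <;> simp [stdVec]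
      right_inv := fun c => by
        funext k; fin_cases i <;> fin_cases k <;> simp [stdVec] }
  refine ⟨Module.Basis.ofEquivFun e, fun p hp => ?_⟩
  rw [Finset.mem_insert, Finset.mem_singleton] at hp
  rcases hp with rfl | rfl
  · refine ⟨0, funext fun k => ?_⟩
    simp [e]
  · refine ⟨1, funext fun k => ?_⟩
    simp [e]

theorem isRegularCone_of_mem_blowUpFan {τ : Finset (Fin 2 → ℕ)} (hτ : τ ∈ blowUpFan) :
    IsRegularCone τ := by
  rcases mem_blowUpFan.1 hτ with rfl | rfl | rfl | rfl | rfl | rfl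
  · exact (isRegularCone_one_stdVec 0).subset (by simp)
  · exact (isRegularCone_one_stdVec 0).subset (by simp)
  · exact (isRegularCone_one_stdVec 0).subset (by simp)
  · exact (isRegularCone_one_stdVec 1).subset (by simp)
  · exact isRegularCone_one_stdVec 0
  · exact isRegularCone_one_stdVec 1

section Interiors

variable {x : Fin 2 → ℝ}

theorem mem_coneInterior_empty : x ∈ coneInterior ∅ ↔ x 0 = 0 ∧ x 1 = 0 := by
  constructor
  · rintro ⟨r, -, rfl⟩
    simp
  · rintro ⟨h0, h1⟩
    refine ⟨fun _ => 0, by simp, funext fun k => ?_⟩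
    fin_cases k <;> simp [h0, h1]

theorem mem_coneInterior_one : x ∈ coneInterior {fun _ => 1} ↔ 0 < x 0 ∧ x 0 = x 1 := by
  rw [mem_coneInterior_singleton]
  constructor
  · rintro ⟨t, ht, rfl⟩
    simp [toReal, ht]
  · rintro ⟨h0, h1⟩
    refine ⟨x 0, h0, funext fun k => ?_⟩
    fin_cases k <;> simp [toReal, h1]

theorem mem_coneInterior_stdVec (i : Fin 2) :
    x ∈ coneInterior {stdVec i} ↔ 0 < x i ∧ x i.rev = 0 := by
  rw [mem_coneInterior_singleton]
  constructor
  · rintro ⟨t, ht, rfl⟩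
    fin_cases i <;> simp [toReal, stdVec, ht]
  · rintro ⟨h0, h1⟩
    refine ⟨x i, h0, funext fun k => ?_⟩
    fin_cases i <;> fin_cases k <;> simp_all [toReal, stdVec]

theorem mem_coneInterior_one_stdVec (i : Fin 2) :
    x ∈ coneInterior {fun _ => 1, stdVec i} ↔ 0 < x i.rev ∧ x i.rev < x i := by
  rw [mem_coneInterior_pair (one_ne_stdVec i)]
  constructor
  · rintro ⟨s, t, hs, ht, rfl⟩
    fin_cases i <;> simp [toReal, stdVec, hs, ht]
  · rintro ⟨h0, h1⟩
    refine ⟨x i.rev, x i - x i.rev, h0, sub_pos.2 h1, funext fun k => ?_⟩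
    fin_cases i <;> fin_cases k <;> simp [toReal, stdVec]

end Interiors

theorem exists_mem_coneInterior_blowUpFan {Q : Fin 2 → ℝ} (hQ : Q ∈ weightCone 2) :
    ∃ τ ∈ blowUpFan, Q ∈ coneInterior τ := by
  have h0 := hQ 0
  have h1 := hQ 1
  rcases h0.eq_or_lt' with h0 | h0 <;> rcases h1.eq_or_lt' with h1 | h1
  · exact ⟨∅, by simp [blowUpFan], mem_coneInterior_empty.2 ⟨h0, h1⟩⟩
  · exact ⟨{stdVec 1}, by simp [blowUpFan], (mem_coneInterior_stdVec 1).2 ⟨h1, h0⟩⟩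
  · exact ⟨{stdVec 0}, by simp [blowUpFan], (mem_coneInterior_stdVec 0).2 ⟨h0, h1⟩⟩
  · rcases lt_trichotomy (Q 0) (Q 1) with h | h | h
    · exact ⟨{fun _ => 1, stdVec 1}, by simp [blowUpFan],
        (mem_coneInterior_one_stdVec 1).2 ⟨h0, h⟩⟩
    · exact ⟨{fun _ => 1}, by simp [blowUpFan], mem_coneInterior_one.2 ⟨h0, h⟩⟩
    · exact ⟨{fun _ => 1, stdVec 0}, by simp [blowUpFan],
        (mem_coneInterior_one_stdVec 0).2 ⟨h1, h⟩⟩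

theorem cone_subset_weightCone {n : ℕ} (τ : Finset (Fin n → ℕ)) : cone τ ⊆ weightCone n := by
  rintro x ⟨r, hr, rfl⟩ i
  rw [Finset.sum_apply]
  exact Finset.sum_nonneg fun p hp => mul_nonneg (hr p hp) (Nat.cast_nonneg _)

/-! ### The dual Newton diagram -/

theorem dualClass_eq_coneInterior {f : MixedPoly 2} {r : ℝ} (hr : 0 < r)
    (hΓ : newtonPolyhedron f = cornerRegion r) {τ : Finset (Fin 2 → ℕ)} (hτ : τ ∈ blowUpFan)
    {Q : Fin 2 → ℝ} (hQ : Q ∈ coneInterior τ) : dualClass f Q = coneInterior τ := by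
  rw [dualClass_eq hr hΓ (cone_subset_weightCone τ (coneInterior_subset_cone τ hQ))]
  ext Q'
  simp only [Set.mem_ofPred_eq, weightCone, Fin.forall_fin_two, SamePosition]
  rcases mem_blowUpFan.1 hτ with rfl | rfl | rfl | rfl | rfl | rfl
  · rw [mem_coneInterior_empty] at hQ ⊢; grind
  · rw [mem_coneInterior_one] at hQ ⊢; grind
  · rw [mem_coneInterior_stdVec, show Fin.rev (0 : Fin 2) = 1 from rfl] at hQ ⊢; grind
  · rw [mem_coneInterior_stdVec, show Fin.rev (1 : Fin 2) = 0 from rfl] at hQ ⊢; grind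
  · rw [mem_coneInterior_one_stdVec, show Fin.rev (0 : Fin 2) = 1 from rfl] at hQ ⊢; grind
  · rw [mem_coneInterior_one_stdVec, show Fin.rev (1 : Fin 2) = 0 from rfl] at hQ ⊢; grind

theorem dualNewtonDiagram_eq {f : MixedPoly 2} {r : ℝ} (hr : 0 < r)
    (hΓ : newtonPolyhedron f = cornerRegion r) :
    dualNewtonDiagram f = cone '' (blowUpFan : Set (Finset (Fin 2 → ℕ))) := by
  ext C
  constructor
  · rintro ⟨Q, hQ, rfl⟩
    obtain ⟨τ, hτ, hQτ⟩ := exists_mem_coneInterior_blowUpFan hQ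
    exact ⟨τ, hτ, by rw [dualClass_eq_coneInterior hr hΓ hτ hQτ,
      (isRegularCone_of_mem_blowUpFan hτ).closure_coneInterior]⟩
  · rintro ⟨τ, hτ, rfl⟩
    have hQ := sum_toReal_mem_coneInterior τ
    exact ⟨_, cone_subset_weightCone τ (coneInterior_subset_cone τ hQ),
      by rw [dualClass_eq_coneInterior hr hΓ hτ hQ,
        (isRegularCone_of_mem_blowUpFan hτ).closure_coneInterior]⟩

theorem dualSubdivision_eq_blowUpFan {f : MixedPoly 2} {r : ℝ} (hr : 0 < r)
    (hΓ : newtonPolyhedron f = cornerRegion r) :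
    dualSubdivision f = (blowUpFan : Set (Finset (Fin 2 → ℕ))) := by
  ext τ
  simp only [dualSubdivision, dualNewtonDiagram_eq hr hΓ, Set.mem_ofPred_eq]
  constructor
  · rintro ⟨hreg, τ', hτ', h⟩
    rwa [hreg.eq_of_cone_eq (isRegularCone_of_mem_blowUpFan hτ') h.symm]
  · exact fun hτ => ⟨isRegularCone_of_mem_blowUpFan hτ, τ, hτ, rfl⟩

/-- The interiors of the cones of the fan are disjoint, being equivalence classes. -/
theorem eq_of_mem_coneInterior {f : MixedPoly 2} {r : ℝ} (hr : 0 < r)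
    (hΓ : newtonPolyhedron f = cornerRegion r) {ρ ρ' : Finset (Fin 2 → ℕ)}
    (hρ : ρ ∈ blowUpFan) (hρ' : ρ' ∈ blowUpFan) {x : Fin 2 → ℝ} (hx : x ∈ coneInterior ρ)
    (hx' : x ∈ coneInterior ρ') : ρ = ρ' := by
  have hreg := isRegularCone_of_mem_blowUpFan hρ
  have hreg' := isRegularCone_of_mem_blowUpFan hρ'
  refine hreg.eq_of_cone_eq hreg' ?_
  rw [← hreg.closure_coneInterior, ← hreg'.closure_coneInterior,
    ← dualClass_eq_coneInterior hr hΓ hρ hx, ← dualClass_eq_coneInterior hr hΓ hρ' hx']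

theorem isRegularSubdivision_blowUpFan {f : MixedPoly 2} {r : ℝ} (hr : 0 < r)
    (hΓ : newtonPolyhedron f = cornerRegion r) :
    IsRegularSubdivision (blowUpFan : Set (Finset (Fin 2 → ℕ))) where
  finite := Finset.finite_toSet _
  regular _ := isRegularCone_of_mem_blowUpFan
  face_mem _ hτ _ h := blowUpFan_face_mem hτ h
  inter_face τ hτ τ' hτ' := by
    classical
    refine ⟨τ ∩ τ', Finset.inter_subset_left, Finset.inter_subset_right,
      Set.Subset.antisymm ?_ (Set.subset_inter (cone_mono Finset.inter_subset_left)
        (cone_mono Finset.inter_subset_right))⟩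
    rintro x ⟨hx, hx'⟩
    obtain ⟨ρ, hρ, hxρ⟩ := mem_cone_iff_exists_subset.1 hx
    obtain ⟨ρ', hρ', hxρ'⟩ := mem_cone_iff_exists_subset.1 hx'
    obtain rfl := eq_of_mem_coneInterior hr hΓ (blowUpFan_face_mem hτ hρ)
      (blowUpFan_face_mem hτ' hρ') hxρ hxρ'
    exact mem_cone_iff_exists_subset.2 ⟨ρ, Finset.subset_inter hρ hρ', hxρ⟩
  support := by
    refine Set.Subset.antisymm (Set.iUnion₂_subset fun τ _ => cone_subset_weightCone τ) ?_
    intro Q hQ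
    obtain ⟨τ, hτ, hQτ⟩ := exists_mem_coneInterior_blowUpFan hQ
    exact Set.mem_iUnion₂.2 ⟨τ, hτ, coneInterior_subset_cone τ hQτ⟩

theorem isAdmissible_blowUpFan {f : MixedPoly 2} {r : ℝ} (hr : 0 < r)
    (hΓ : newtonPolyhedron f = cornerRegion r) :
    IsAdmissible f (blowUpFan : Set (Finset (Fin 2 → ℕ))) := fun τ hτ =>
  (dualClass_eq_coneInterior hr hΓ hτ (sum_toReal_mem_coneInterior τ)).ge

/-! ### The affine charts of the blow-up -/

/-- The affine coordinates `w / wᵢ` of a point `[w]` of projective space, normalized to have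
`i`-th coordinate `1`; the value is `0` if `wᵢ = 0`. -/
noncomputable def affineCoord {n : ℕ} (i : Fin n) (l : ℙ ℂ (Fin n → ℂ)) : Fin n → ℂ :=
  (l.rep i)⁻¹ • l.rep

theorem affineCoord_mk {n : ℕ} (i : Fin n) (w : Fin n → ℂ) (hw : w ≠ 0) :
    affineCoord i (Projectivization.mk ℂ w hw) = (w i)⁻¹ • w := by
  obtain ⟨a, ha⟩ := Projectivization.exists_smul_eq_mk_rep ℂ w hw
  have ha0 : (a : ℂ) ≠ 0 := a.ne_zero
  rw [affineCoord, ← ha]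
  funext j
  simp only [Units.smul_def, Pi.smul_apply, smul_eq_mul, mul_inv]
  field_simp

/-- The affine part `wᵢ ≠ 0` of projective space. -/
def affinePart {n : ℕ} (i : Fin n) : Set (ℙ ℂ (Fin n → ℂ)) := {l | l.rep i ≠ 0}

theorem mk_mem_affinePart {n : ℕ} {i : Fin n} {w : Fin n → ℂ} {hw : w ≠ 0} :
    Projectivization.mk ℂ w hw ∈ affinePart i ↔ w i ≠ 0 := by
  obtain ⟨a, ha⟩ := Projectivization.exists_smul_eq_mk_rep ℂ w hw
  rw [affinePart, Set.mem_ofPred_eq, ← ha]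
  simp [Units.smul_def]

theorem isOpen_affinePart {n : ℕ} (i : Fin n) : IsOpen (affinePart i) := by
  rw [isOpen_coinduced]
  have : Projectivization.mk' ℂ ⁻¹' affinePart i =
      {w : {w : Fin n → ℂ // w ≠ 0} | w.1 i ≠ 0} := by
    ext w
    exact mk_mem_affinePart
  rw [this]
  exact isOpen_ne_fun ((continuous_apply i).comp continuous_subtype_val) continuous_const

theorem continuousOn_affineCoord {n : ℕ} (i : Fin n) :
    ContinuousOn (affineCoord i) (affinePart i) := by
  rw [continuousOn_open_iff (isOpen_affinePart i)]
  intro V hV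
  rw [isOpen_coinduced]
  have : Projectivization.mk' ℂ ⁻¹' (affinePart i ∩ affineCoord i ⁻¹' V) =
      {w : {w : Fin n → ℂ // w ≠ 0} | w.1 i ≠ 0} ∩ (fun w => (w.1 i)⁻¹ • w.1) ⁻¹' V := by
    ext w
    refine and_congr mk_mem_affinePart ?_
    rw [Set.mem_preimage, Set.mem_preimage, Projectivization.mk'_eq_mk, affineCoord_mk]
  rw [this]
  have hc : Continuous fun w : {w : Fin n → ℂ // w ≠ 0} => w.1 i :=
    (continuous_apply i).comp continuous_subtype_val
  exact ((hc.continuousOn.inv₀ fun w hw => hw).smul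
    continuous_subtype_val.continuousOn).isOpen_inter_preimage
    (isOpen_ne_fun hc continuous_const) hV

theorem continuous_blowUpChart {n : ℕ} (i : Fin n) : Continuous (blowUpChart i) := by
  have hw : Continuous fun a : Fin n → ℂ => Function.update a i (1 : ℂ) :=
    continuous_id.update i continuous_const
  have hl : Continuous fun a : Fin n → ℂ =>
      Projectivization.mk ℂ (Function.update a i 1) (update_one_ne_zero i a) :=
    Continuous.comp (g := Projectivization.mk' ℂ)
      (f := fun a => ⟨Function.update a i 1, update_one_ne_zero i a⟩)
      continuous_coinduced_rng (hw.subtype_mk _)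
  exact (((continuous_apply i).smul hw).prodMk hl).subtype_mk _

/-- The inverse of a standard chart of the blow-up. -/
noncomputable def blowUpCoord {n : ℕ} (i : Fin n) (x : BlowUp n) : Fin n → ℂ :=
  Function.update (affineCoord i x.1.2) i (x.1.1 i)

theorem blowUpCoord_blowUpChart {n : ℕ} (i : Fin n) (a : Fin n → ℂ) :
    blowUpCoord i (blowUpChart i a) = a := by
  funext j
  rcases eq_or_ne j i with rfl | hj
  · simp [blowUpCoord, blowUpChart]
  · simp [blowUpCoord, blowUpChart, affineCoord_mk, hj]

theorem blowUpChart_injective {n : ℕ} (i : Fin n) : Function.Injective (blowUpChart i) :=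
  Function.LeftInverse.injective (blowUpCoord_blowUpChart i)

theorem blowUpChart_blowUpCoord {n : ℕ} {i : Fin n} {x : BlowUp n} (hx : x.1.2 ∈ affinePart i) :
    blowUpChart i (blowUpCoord i x) = x := by
  obtain ⟨⟨z, l⟩, hz⟩ := x
  induction l using Projectivization.ind with
  | h w hw =>
    have hwi : w i ≠ 0 := mk_mem_affinePart.1 hx
    rw [Projectivization.submodule_mk, Submodule.mem_span_singleton] at hz
    obtain ⟨c, rfl⟩ := hz
    have hu : Function.update (Function.update ((w i)⁻¹ • w) i ((c • w) i)) i 1 =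
        (w i)⁻¹ • w := by
      funext j
      rcases eq_or_ne j i with rfl | hj
      · simp [hwi]
      · simp [hj]
    refine Subtype.ext (Prod.ext ?_ ?_)
    · simp only [blowUpChart, blowUpCoord, affineCoord_mk, hu, Function.update_self]
      rw [smul_smul, Pi.smul_apply, smul_eq_mul, mul_assoc, mul_inv_cancel₀ hwi, mul_one]
    · simp only [blowUpChart, blowUpCoord, affineCoord_mk, hu]
      rw [Projectivization.mk_eq_mk_iff']
      exact ⟨(w i)⁻¹, rfl⟩

theorem exists_mem_affinePart {n : ℕ} (l : ℙ ℂ (Fin n → ℂ)) : ∃ i, l ∈ affinePart i :=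
  Function.ne_iff.1 l.rep_nonzero

theorem isOpenMap_blowUpChart {n : ℕ} (i : Fin n) : IsOpenMap (blowUpChart i) := by
  intro U hU
  have hp : Continuous fun x : BlowUp n => x.1.2 := continuous_snd.comp continuous_subtype_val
  have hz : Continuous fun x : BlowUp n => x.1.1 := continuous_fst.comp continuous_subtype_val
  have himage : blowUpChart i '' U =
      (fun x : BlowUp n => x.1.2) ⁻¹' affinePart i ∩ blowUpCoord i ⁻¹' U := by
    ext x
    constructor
    · rintro ⟨a, ha, rfl⟩
      refine ⟨?_, ?_⟩
      · exact mk_mem_affinePart.2 (by simp)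
      · rwa [Set.mem_preimage, blowUpCoord_blowUpChart]
    · rintro ⟨hx, hxU⟩
      exact ⟨_, hxU, blowUpChart_blowUpCoord hx⟩
  rw [himage]
  refine ContinuousOn.isOpen_inter_preimage ?_ ((isOpen_affinePart i).preimage hp) hU
  have h1 : ContinuousOn (fun x : BlowUp n => affineCoord i x.1.2)
      ((fun x : BlowUp n => x.1.2) ⁻¹' affinePart i) :=
    (continuousOn_affineCoord i).comp hp.continuousOn fun x hx => hx
  have h2 : ContinuousOn (fun x : BlowUp n => x.1.1 i)
      ((fun x : BlowUp n => x.1.2) ⁻¹' affinePart i) :=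
    ((continuous_apply i).comp hz).continuousOn
  exact fun x hx => (h1 x hx).update i (h2 x hx)

/-- The overlap of the two charts of the blow-up of the plane. -/
theorem blowUpChart_eq_blowUpChart_iff {i j : Fin 2} (hij : i ≠ j) {a b : Fin 2 → ℂ} :
    blowUpChart i a = blowUpChart j b ↔ a j ≠ 0 ∧ b j = a i * a j ∧ b i = (a j)⁻¹ := by
  constructor
  · intro h
    have hb := blowUpCoord_blowUpChart j b
    have hj : (blowUpChart j b).1.2 ∈ affinePart j := mk_mem_affinePart.2 (by simp)
    rw [← h] at hb hj
    have hj' : a j ≠ 0 := by simpa [hij.symm] using mk_mem_affinePart.1 hj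
    refine ⟨hj', ?_, ?_⟩
    · rw [← hb]; simp [blowUpCoord, blowUpChart, hij.symm]
    · rw [← hb]; simp [blowUpCoord, blowUpChart, affineCoord_mk, hij, hij.symm]
  · rintro ⟨hj, hbj, hbi⟩
    have hmem : (blowUpChart i a).1.2 ∈ affinePart j :=
      mk_mem_affinePart.2 (by simpa [hij.symm] using hj)
    have hb : blowUpCoord j (blowUpChart i a) = b := by
      funext k
      have hk : k = i ∨ k = j := by omega
      rcases hk with rfl | rfl
      · rw [hbi]; simp [blowUpCoord, blowUpChart, affineCoord_mk, hij, hij.symm]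
      · rw [hbj]; simp [blowUpCoord, blowUpChart, hij.symm]
    rw [← hb, blowUpChart_blowUpCoord hmem]

/-! ### The toric space of the fan of the blow-up -/

/-- The vertices of the `i`-th maximal cone of the fan of the blow-up: `(1, 1)` at the index `i`,
and the standard basis vector at the other index. -/
def maxConeVertex (i : Fin 2) : Fin 2 → Fin 2 → ℕ := Function.update stdVec i fun _ => 1

theorem maxConeVertex_injective (i : Fin 2) : Function.Injective (maxConeVertex i) := by
  revert i; decide

theorem image_maxConeVertex_mem (i : Fin 2) :
    Finset.univ.image (maxConeVertex i) ∈ blowUpFan ∧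
      (Finset.univ.image (maxConeVertex i)).card = 2 := by
  revert i; decide

theorem exists_eq_image_maxConeVertex {τ : Finset (Fin 2 → ℕ)} (hτ : τ ∈ blowUpFan)
    (hcard : τ.card = 2) : ∃ i, τ = Finset.univ.image (maxConeVertex i) := by
  have : ∀ τ ∈ blowUpFan, τ.card = 2 → ∃ i, τ = Finset.univ.image (maxConeVertex i) := by decide
  exact this τ hτ hcard

/-- The maximal cones of the fan of the blow-up of the plane. -/
abbrev BlowUpCone : Type := MaxCone (blowUpFan : Set (Finset (Fin 2 → ℕ)))

/-- The index of a maximal cone `σ`, with `σ` spanned by the vertices `maxConeVertex σ.index`. -/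
noncomputable def BlowUpCone.index (σ : BlowUpCone) : Fin 2 :=
  (exists_eq_image_maxConeVertex σ.2.1 σ.2.2).choose

theorem BlowUpCone.eq_image (σ : BlowUpCone) :
    σ.1 = Finset.univ.image (maxConeVertex σ.index) :=
  (exists_eq_image_maxConeVertex σ.2.1 σ.2.2).choose_spec

theorem BlowUpCone.index_surjective : Function.Surjective BlowUpCone.index := by
  intro i
  refine ⟨⟨_, image_maxConeVertex_mem i⟩, ?_⟩
  have h := BlowUpCone.eq_image ⟨_, image_maxConeVertex_mem i⟩
  have : ∀ i j, Finset.univ.image (maxConeVertex i) = Finset.univ.image (maxConeVertex j) →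
      j = i := by decide
  exact this _ _ h

/-- The vertices of a maximal cone, indexed by `Fin 2`. -/
noncomputable def BlowUpCone.vertexEquiv (σ : BlowUpCone) : Fin 2 ≃ {p // p ∈ σ.1} :=
  Equiv.ofBijective
    (fun k => ⟨maxConeVertex σ.index k, by
      have := σ.eq_image
      rw [this]
      exact Finset.mem_image_of_mem _ (Finset.mem_univ k)⟩)
    ⟨fun k k' h => maxConeVertex_injective _ (congrArg Subtype.val h), fun p => by
      have hp : p.1 ∈ Finset.univ.image (maxConeVertex σ.index) := by
        rw [← σ.eq_image]
        exact p.2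
      obtain ⟨k, -, hk⟩ := Finset.mem_image.1 hp
      exact ⟨k, Subtype.ext hk⟩⟩

theorem BlowUpCone.vertexEquiv_val (σ : BlowUpCone) (k : Fin 2) :
    (σ.vertexEquiv k).1 = maxConeVertex σ.index k := rfl

/-- The toric coordinates on the chart of `σ`, indexed by `Fin 2`. -/
noncomputable def BlowUpCone.coord (σ : BlowUpCone) : ChartSpace σ ≃L[ℂ] (Fin 2 → ℂ) :=
  (LinearEquiv.funCongrLeft ℂ ℂ σ.vertexEquiv).toContinuousLinearEquiv

theorem BlowUpCone.coord_apply (σ : BlowUpCone) (u : ChartSpace σ) (k : Fin 2) :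
    σ.coord u k = u (σ.vertexEquiv k) := rfl

theorem toricMorphism_eq_smul_update (σ : BlowUpCone) (u : ChartSpace σ) :
    toricMorphism σ u = σ.coord u σ.index •
      Function.update (σ.coord u) σ.index 1 := by
  funext k
  simp only [toricMorphism]
  rw [← Equiv.prod_comp σ.vertexEquiv]
  simp only [← BlowUpCone.coord_apply, BlowUpCone.vertexEquiv_val]
  generalize σ.coord u = a
  generalize σ.index = i
  fin_cases i <;> fin_cases k <;> simp [maxConeVertex, stdVec, mul_comm]

theorem toricMorphism_eq_blowDown (σ : BlowUpCone) (u : ChartSpace σ) :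
    toricMorphism σ u = blowDown (blowUpChart σ.index (σ.coord u)) :=
  toricMorphism_eq_smul_update σ u

/-- The gluing of the toric charts in terms of the coordinates indexed by `Fin 2`. -/
theorem glue_iff_exists (σ τ : BlowUpCone) (u : ChartSpace σ) (v : ChartSpace τ) :
    Glue ⟨σ, u⟩ ⟨τ, v⟩ ↔ ∃ l : Fin 2 → Fin 2 → ℤ,
      (∀ p m, (maxConeVertex σ.index p m : ℤ) =
        ∑ q, l q p * (maxConeVertex τ.index q m : ℤ)) ∧
      (∀ p, σ.coord u p = 0 → ∀ q, 0 ≤ l q p) ∧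
      ∀ q, τ.coord v q = ∏ p, σ.coord u p ^ l q p := by
  constructor
  · rintro ⟨l, h1, h2, h3⟩
    refine ⟨fun q p => l (τ.vertexEquiv q) (σ.vertexEquiv p),
      fun p m => ?_, fun p hp q => h2 _ hp _, fun q => ?_⟩
    · have := h1 (σ.vertexEquiv p) m
      rwa [← Equiv.sum_comp τ.vertexEquiv] at this
    · have := h3 (τ.vertexEquiv q)
      rwa [← Equiv.prod_comp σ.vertexEquiv] at this
  · rintro ⟨l, h1, h2, h3⟩
    refine ⟨fun q p => l (τ.vertexEquiv.symm q) (σ.vertexEquiv.symm p),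
      fun p m => ?_, fun p hp q => ?_, fun q => ?_⟩
    · obtain ⟨p, rfl⟩ := σ.vertexEquiv.surjective p
      rw [← Equiv.sum_comp τ.vertexEquiv]
      simp only [Equiv.symm_apply_apply]
      exact h1 p m
    · obtain ⟨p, rfl⟩ := σ.vertexEquiv.surjective p
      simp only [Equiv.symm_apply_apply]
      exact h2 p hp _
    · obtain ⟨q, rfl⟩ := τ.vertexEquiv.surjective q
      rw [← Equiv.prod_comp σ.vertexEquiv]
      simp only [Equiv.symm_apply_apply]
      exact h3 q

/-- The toric charts are glued exactly as the standard charts of the blow-up overlap. -/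
theorem glue_iff (σ τ : BlowUpCone) (u : ChartSpace σ) (v : ChartSpace τ) :
    Glue ⟨σ, u⟩ ⟨τ, v⟩ ↔ blowUpChart σ.index (σ.coord u) =
      blowUpChart τ.index (τ.coord v) := by
  rw [glue_iff_exists]
  generalize σ.coord u = a
  generalize τ.coord v = b
  generalize σ.index = i
  generalize τ.index = j
  rcases eq_or_ne i j with rfl | hij
  · rw [(blowUpChart_injective i).eq_iff]
    constructor
    · rintro ⟨l, h1, -, h3⟩
      -- the matrix of vertices is invertible, so the exponent matrix is the identity
      have hl : ∀ q p, l q p = if q = p then 1 else 0 := by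
        simp only [Fin.forall_fin_two, Fin.sum_univ_two] at h1 ⊢
        fin_cases i <;> simp [maxConeVertex, stdVec] at h1 ⊢ <;> omega
      funext q
      rw [h3 q]
      simp only [hl, Fin.prod_univ_two]
      fin_cases q <;> simp
    · rintro rfl
      refine ⟨fun q p => if q = p then 1 else 0, fun p m => by simp, fun p _ q => ?_, fun q => ?_⟩
      · dsimp only; split_ifs <;> simp
      · rw [Finset.prod_eq_single q] <;> simp +contextual [eq_comm]
  · rw [blowUpChart_eq_blowUpChart_iff hij]
    constructor
    · rintro ⟨l, h1, h2, h3⟩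
      have hl : l j i = 1 ∧ l j j = 1 ∧ l i i = 0 ∧ l i j = -1 := by
        simp only [Fin.forall_fin_two, Fin.sum_univ_two] at h1
        fin_cases i <;> fin_cases j <;> simp [maxConeVertex, stdVec] at h1 hij ⊢ <;> omega
      obtain ⟨l1, l2, l3, l4⟩ := hl
      have hprod : ∀ c : Fin 2 → ℂ, ∏ p, c p = c i * c j := by
        intro c
        fin_cases i <;> fin_cases j <;> simp [mul_comm] at hij ⊢
      refine ⟨fun h => ?_, ?_, ?_⟩
      · have := h2 j h i
        omega
      · rw [h3 j, hprod, l1, l2]; simp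
      · rw [h3 i, hprod, l3, l4]; simp
    · rintro ⟨hj, hbj, hbi⟩
      refine ⟨fun q p => if q = j then 1 else if p = j then -1 else 0, ?_, ?_, ?_⟩
      · intro p m
        rw [Fin.sum_univ_two]
        clear hj hbj hbi
        revert i j p m; decide
      · intro p hp q
        have : p ≠ j := by rintro rfl; exact hj hp
        dsimp only
        split_ifs <;> simp
      · intro q
        fin_cases i <;> fin_cases j <;> fin_cases q <;>
          simp at hij hbi hbj ⊢ <;> simp [hbi, hbj, mul_comm]

/-- The isomorphism from the toric space of the fan to the blow-up: the chart of `σ` is sent to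
the standard chart with the same index. -/
noncomputable def toricToBlowUp :
    ToricSpace (blowUpFan : Set (Finset (Fin 2 → ℕ))) → BlowUp 2 :=
  Quot.lift (fun x => blowUpChart (BlowUpCone.index x.1) (BlowUpCone.coord x.1 x.2)) fun x y h =>
    (glue_iff x.1 y.1 x.2 y.2).1 h

theorem toricToBlowUp_toricChart (σ : BlowUpCone) (u : ChartSpace σ) :
    toricToBlowUp (toricChart σ u) = blowUpChart σ.index (σ.coord u) := rfl

theorem continuous_toricChart {n : ℕ} {S : Set (Finset (Fin n → ℕ))} (σ : MaxCone S) :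
    Continuous (toricChart σ) :=
  continuous_quot_mk.comp continuous_sigmaMk

theorem exists_toricChart_eq {n : ℕ} {S : Set (Finset (Fin n → ℕ))} (x : ToricSpace S) :
    ∃ (σ : MaxCone S) (u : ChartSpace σ), toricChart σ u = x := by
  obtain ⟨⟨σ, u⟩, rfl⟩ := Quot.exists_rep x
  exact ⟨σ, u, rfl⟩

theorem continuous_toricToBlowUp : Continuous toricToBlowUp := by
  refine continuous_quot_lift _ (continuous_sigma fun σ => ?_)
  exact (continuous_blowUpChart (BlowUpCone.index σ)).comp (BlowUpCone.coord σ).continuous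

theorem toricToBlowUp_injective : Function.Injective toricToBlowUp := by
  intro x y h
  obtain ⟨σ, u, rfl⟩ := exists_toricChart_eq x
  obtain ⟨τ, v, rfl⟩ := exists_toricChart_eq y
  exact Quot.sound ((glue_iff σ τ u v).2 h)

theorem toricToBlowUp_surjective : Function.Surjective toricToBlowUp := by
  intro x
  obtain ⟨i, hi⟩ := exists_mem_affinePart x.1.2
  obtain ⟨σ, rfl⟩ := BlowUpCone.index_surjective i
  refine ⟨toricChart σ (σ.coord.symm (blowUpCoord σ.index x)), ?_⟩
  rw [toricToBlowUp_toricChart, ContinuousLinearEquiv.apply_symm_apply,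
    blowUpChart_blowUpCoord hi]

theorem isOpenMap_toricToBlowUp : IsOpenMap toricToBlowUp := by
  intro O hO
  have himage : toricToBlowUp '' O =
      ⋃ σ : BlowUpCone, (blowUpChart σ.index ∘ σ.coord) '' (toricChart σ ⁻¹' O) := by
    ext x
    rw [Set.mem_iUnion]
    constructor
    · rintro ⟨y, hy, rfl⟩
      obtain ⟨σ, u, rfl⟩ := exists_toricChart_eq y
      exact ⟨σ, u, hy, rfl⟩
    · rintro ⟨σ, u, hu, rfl⟩
      exact ⟨_, hu, rfl⟩
  rw [himage]
  exact isOpen_iUnion fun σ => ((isOpenMap_blowUpChart _).comp σ.coord.isOpenMap) _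
    (hO.preimage (continuous_toricChart σ))

/-- The toric space of the fan is homeomorphic to the blow-up. -/
noncomputable def toricHomeomorphBlowUp :
    ToricSpace (blowUpFan : Set (Finset (Fin 2 → ℕ))) ≃ₜ BlowUp 2 :=
  (Equiv.ofBijective toricToBlowUp
    ⟨toricToBlowUp_injective, toricToBlowUp_surjective⟩).toHomeomorphOfContinuousOpen
    continuous_toricToBlowUp isOpenMap_toricToBlowUp

theorem toricHomeomorphBlowUp_toricChart (σ : BlowUpCone) (u : ChartSpace σ) :
    toricHomeomorphBlowUp (toricChart σ u) = blowUpChart σ.index (σ.coord u) := rfl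

theorem isOrdinaryBlowUp_blowUpFan :
    IsOrdinaryBlowUp (blowUpFan : Set (Finset (Fin 2 → ℕ))) := by
  refine ⟨toricHomeomorphBlowUp, fun x => ?_, fun σ u => ?_, fun i a => ?_⟩
  · obtain ⟨σ, u, rfl⟩ := exists_toricChart_eq x
    exact (toricMorphism_eq_blowDown σ u).symm
  · exact ⟨BlowUpCone.index σ, BlowUpCone.coord σ, (BlowUpCone.coord σ).analyticAt u,
      Filter.Eventually.of_forall fun _ => rfl⟩
  · obtain ⟨σ, rfl⟩ := BlowUpCone.index_surjective i
    refine ⟨σ, σ.coord.symm, σ.coord.symm.analyticAt a, Filter.Eventually.of_forall fun b => ?_⟩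
    rw [Homeomorph.symm_apply_eq, toricHomeomorphBlowUp_toricChart,
      ContinuousLinearEquiv.apply_symm_apply]

theorem isOpenMap_toricChart (σ : BlowUpCone) : IsOpenMap (toricChart σ) := by
  have : toricChart σ = toricHomeomorphBlowUp.symm ∘ blowUpChart σ.index ∘ σ.coord := by
    funext u
    rw [Function.comp_apply, Homeomorph.eq_symm_apply, toricHomeomorphBlowUp_toricChart]
    rfl
  rw [this]
  exact toricHomeomorphBlowUp.symm.isOpenMap.comp
    ((isOpenMap_blowUpChart _).comp σ.coord.isOpenMap)

/-! ### Bihomogeneous mixed polynomials -/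

theorem evalMixed_eq_sum {n : ℕ} (f : MixedPoly n) (z : Fin n → ℂ) :
    evalMixed f z = ∑ m ∈ f.support, f m * (∏ i, z i ^ m.1 i) * ∏ i, conj (z i) ^ m.2 i := rfl

theorem analyticOnNhd_evalMixed {n : ℕ} (f : MixedPoly n) :
    AnalyticOnNhd ℝ (evalMixed f) Set.univ := by
  intro z _
  have hz : ∀ i, AnalyticAt ℝ (fun z : Fin n → ℂ => z i) z := fun i =>
    (ContinuousLinearMap.proj (R := ℝ) (φ := fun _ : Fin n => ℂ) i).analyticAt z
  have hzc : ∀ i, AnalyticAt ℝ (fun z : Fin n → ℂ => conj (z i)) z := fun i =>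
    (Complex.conjCLE.toContinuousLinearMap.comp
      (ContinuousLinearMap.proj (R := ℝ) (φ := fun _ : Fin n => ℂ) i)).analyticAt z
  have h1 : ∀ ν : Fin n → ℕ, AnalyticAt ℝ (fun z : Fin n → ℂ => ∏ i, z i ^ ν i) z := fun ν =>
    Finset.analyticAt_fun_prod _ fun i _ => (hz i).fun_pow _
  have h2 : ∀ μ : Fin n → ℕ, AnalyticAt ℝ (fun z : Fin n → ℂ => ∏ i, conj (z i) ^ μ i) z :=
    fun μ => Finset.analyticAt_fun_prod _ fun i _ => (hzc i).fun_pow _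
  have h3 : evalMixed f = fun z => ∑ m ∈ f.support,
      f m * (∏ i, z i ^ m.1 i) * ∏ i, conj (z i) ^ m.2 i := funext (evalMixed_eq_sum f)
  rw [h3]
  exact Finset.analyticAt_fun_sum _ fun m _ =>
    (analyticAt_const.fun_mul (h1 m.1)).fun_mul (h2 m.2)

theorem continuous_evalMixed {n : ℕ} (f : MixedPoly n) : Continuous (evalMixed f) :=
  continuous_iff_continuousAt.2 fun z => (analyticOnNhd_evalMixed f z trivial).continuousAt

/-- All terms of `f` have degree `a` in the variables and degree `b` in their conjugates. -/
def IsBihomogeneous {n : ℕ} (f : MixedPoly n) (a b : ℕ) : Prop :=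
  ∀ ν μ, f (ν, μ) ≠ 0 → ∑ i, ν i = a ∧ ∑ i, μ i = b

/-- The radial and the polar degree for the weight `(1, …, 1)` are the sum and the difference of
the degrees in the variables and in their conjugates. -/
theorem exists_isBihomogeneous {n : ℕ} {f : MixedPoly n} {r : ℕ} {p : ℤ}
    (hr : HasRadialDegree f (fun _ => 1) r) (hp : HasPolarDegree f (fun _ => 1) p) :
    ∃ a b, IsBihomogeneous f a b ∧ (f ≠ 0 → a + b = r) := by
  have key : ∀ ν μ, f (ν, μ) ≠ 0 → ∑ i, ν i + ∑ i, μ i = r ∧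
      (∑ i, (ν i : ℤ)) - ∑ i, (μ i : ℤ) = p := by
    intro ν μ h
    have h1 := hr.2.2.2 ν μ h
    have h2 := hp.2.2 ν μ h
    simp only [one_mul, Finset.sum_add_distrib, Finset.sum_sub_distrib] at h1 h2
    exact ⟨by exact_mod_cast h1, by exact_mod_cast h2⟩
  by_cases hf : f = 0
  · exact ⟨0, 0, fun ν μ h => (h (by simp [hf])).elim, fun h => (h hf).elim⟩
  · obtain ⟨⟨ν₀, μ₀⟩, h₀⟩ := Finsupp.ne_iff.1 hf
    obtain ⟨h1, h2⟩ := key ν₀ μ₀ h₀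
    refine ⟨∑ i, ν₀ i, ∑ i, μ₀ i, fun ν μ h => ?_, fun _ => h1⟩
    obtain ⟨h3, h4⟩ := key ν μ h
    rw [← Nat.cast_sum, ← Nat.cast_sum] at h2 h4
    omega

theorem IsBihomogeneous.evalMixed_smul {n : ℕ} {f : MixedPoly n} {a b : ℕ}
    (hf : IsBihomogeneous f a b) (c : ℂ) (z : Fin n → ℂ) :
    evalMixed f (c • z) = c ^ a * conj c ^ b * evalMixed f z := by
  rw [evalMixed_eq_sum, evalMixed_eq_sum, Finset.mul_sum]
  refine Finset.sum_congr rfl fun m hm => ?_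
  obtain ⟨h1, h2⟩ := hf m.1 m.2 (Finsupp.mem_support_iff.1 hm)
  simp only [Pi.smul_apply, smul_eq_mul, map_mul, mul_pow, Finset.prod_mul_distrib,
    Finset.prod_pow_eq_pow_sum, h1, h2]
  ring

theorem IsBihomogeneous.evalMixed_smul_eq_zero_iff {n : ℕ} {f : MixedPoly n} {a b : ℕ}
    (hf : IsBihomogeneous f a b) {c : ℂ} (hc : c ≠ 0) (z : Fin n → ℂ) :
    evalMixed f (c • z) = 0 ↔ evalMixed f z = 0 := by
  rw [hf.evalMixed_smul]
  simp [hc]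

theorem IsBihomogeneous.evalMixed_zero {n : ℕ} {f : MixedPoly n} {a b : ℕ}
    (hf : IsBihomogeneous f a b) (hab : 0 < a + b) : evalMixed f 0 = 0 := by
  have h := hf.evalMixed_smul 0 0
  rw [smul_zero] at h
  rw [h, map_zero, ← pow_add, zero_pow hab.ne', zero_mul]

theorem IsBihomogeneous.evalMixed_single_ne_zero {n : ℕ} {f : MixedPoly n} {a b : ℕ}
    (hf : IsBihomogeneous f a b) {i : Fin n} (h : RestrictionNonzero f {i}) :
    evalMixed f (Pi.single i 1) ≠ 0 := by
  obtain ⟨z, hz, hfz⟩ := h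
  have : z = z i • Pi.single i 1 := by
    funext j
    rcases eq_or_ne j i with rfl | hj
    · simp
    · simp [hj, hz j (by simpa using hj)]
  rw [this, hf.evalMixed_smul] at hfz
  exact right_ne_zero_of_mul hfz

theorem exists_coeff_ne_zero_of_evalMixed_single {n : ℕ} {f : MixedPoly n} {i : Fin n}
    (h : evalMixed f (Pi.single i 1) ≠ 0) :
    ∃ ν μ, f (ν, μ) ≠ 0 ∧ ∀ j, j ≠ i → (ν + μ) j = 0 := by
  rw [evalMixed_eq_sum] at h
  obtain ⟨⟨ν, μ⟩, hm, hne⟩ := Finset.exists_ne_zero_of_sum_ne_zero h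
  refine ⟨ν, μ, Finsupp.mem_support_iff.1 hm, fun j hj => ?_⟩
  have h1 := Finset.prod_ne_zero_iff.1 (right_ne_zero_of_mul (left_ne_zero_of_mul hne)) j
    (Finset.mem_univ j)
  have h2 := Finset.prod_ne_zero_iff.1 (right_ne_zero_of_mul hne) j (Finset.mem_univ j)
  simp only [Pi.single_eq_of_ne hj, map_zero, ne_eq, zero_pow_eq_zero] at h1 h2
  rw [Pi.add_apply]
  omega

/-- Euler's relation: a zero of a bihomogeneous mixed polynomial spans a complex line of zeros,
along which the differential vanishes. -/
theorem IsBihomogeneous.fderiv_smul_eq_zero {n : ℕ} {f : MixedPoly n} {a b : ℕ}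
    (hf : IsBihomogeneous f a b) {w : Fin n → ℂ} (hw : evalMixed f w = 0) (c : ℂ) :
    fderiv ℝ (evalMixed f) w (c • w) = 0 := by
  let L : ℂ →L[ℝ] (Fin n → ℂ) := (ContinuousLinearMap.id ℝ ℂ).smulRight w
  have h1 : HasFDerivAt (evalMixed f) (fderiv ℝ (evalMixed f) w) (L 1) := by
    have : L 1 = w := by simp [L]
    rw [this]
    exact (analyticOnNhd_evalMixed f w trivial).differentiableAt.hasFDerivAt
  have h2 := h1.comp (1 : ℂ) L.hasFDerivAt
  have h3 : evalMixed f ∘ L = fun _ => 0 := by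
    funext s
    simp [L, hf.evalMixed_smul, hw]
  rw [h3] at h2
  have h4 := h2.unique (hasFDerivAt_const (0 : ℂ) (1 : ℂ))
  have := congrArg (fun T : ℂ →L[ℝ] ℂ => T c) h4
  simpa [L] using this

theorem surjective_fderiv_of_not_isMixedCriticalPoint {n : ℕ} {f : MixedPoly n} {w : Fin n → ℂ}
    (h : ¬ IsMixedCriticalPoint f w) : Function.Surjective (fderiv ℝ (evalMixed f) w) := by
  have h2 : Module.finrank ℝ (LinearMap.range (fderiv ℝ (evalMixed f) w).toLinearMap) =
      Module.finrank ℝ ℂ := by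
    refine le_antisymm (Submodule.finrank_le _) ?_
    rw [Complex.finrank_real_complex]
    exact not_lt.1 h
  exact LinearMap.range_eq_top.1 (Submodule.eq_top_of_finrank_eq h2)

/-! ### The strict transform -/

/-- The zero set of a complex-valued real analytic submersion is a submanifold of
codimension `2`. -/
theorem isAnalyticSubmanifoldAt_zeros {E : Type*} [NormedAddCommGroup E] [NormedSpace ℝ E]
    {F : E → ℂ} {d : ℕ} {x : E} (hd : 2 + d = Module.finrank ℝ E)
    (hF : AnalyticOnNhd ℝ F Set.univ) (hx : Function.Surjective (fderiv ℝ F x)) :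
    IsAnalyticSubmanifoldAt {y | F y = 0} d x := by
  let T : ℂ ≃L[ℝ] (Fin 2 → ℝ) := Complex.basisOneI.equivFun.toContinuousLinearEquiv
  refine ⟨2, Set.univ, T ∘ F, hd, isOpen_univ, trivial, fun y _ => ?_, ?_, ?_⟩
  · exact (T.toContinuousLinearMap.analyticAt (F y)).comp (hF y trivial)
  · rw [T.comp_fderiv]
    exact T.surjective.comp hx
  · ext y
    simp

/-- In each chart, the strict transform is the product of the exceptional coordinate with the zero
set of the dehomogenized polynomial. -/
theorem IsBihomogeneous.toricChart_preimage_strictTransform {f : MixedPoly 2} {a b : ℕ}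
    (hf : IsBihomogeneous f a b) (σ : BlowUpCone) :
    toricChart σ ⁻¹' strictTransform f (blowUpFan : Set (Finset (Fin 2 → ℕ))) =
      {u | evalMixed f (Function.update (σ.coord u) σ.index 1) = 0} := by
  rw [strictTransform, (isOpenMap_toricChart σ).preimage_closure_eq_closure_preimage
    (continuous_toricChart σ)]
  have hpre : toricChart σ ⁻¹' (toricModification (blowUpFan : Set (Finset (Fin 2 → ℕ))) ⁻¹'
      ({z | evalMixed f z = 0} \ {0})) = {u | σ.coord u σ.index ≠ 0 ∧
        evalMixed f (Function.update (σ.coord u) σ.index 1) = 0} := by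
    ext u
    change (evalMixed f (toricMorphism σ u) = 0 ∧ toricMorphism σ u ≠ 0) ↔ _
    rw [toricMorphism_eq_smul_update, smul_ne_zero_iff, and_comm]
    constructor
    · rintro ⟨⟨h0, -⟩, h⟩
      exact ⟨h0, (hf.evalMixed_smul_eq_zero_iff h0 _).1 h⟩
    · rintro ⟨h0, h⟩
      exact ⟨⟨h0, update_one_ne_zero _ _⟩, (hf.evalMixed_smul_eq_zero_iff h0 _).2 h⟩
  rw [hpre]
  apply Set.Subset.antisymm
  · refine closure_minimal (fun u hu => hu.2) (isClosed_eq ?_ continuous_const)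
    exact (continuous_evalMixed f).comp (σ.coord.continuous.update _ continuous_const)
  · intro u hu
    -- move the exceptional coordinate of `u` away from `0`
    let γ : ℂ → ChartSpace σ := fun s => σ.coord.symm (Function.update (σ.coord u) σ.index s)
    have hγ : Continuous γ :=
      σ.coord.symm.continuous.comp (continuous_const.update _ continuous_id)
    have hu' : γ (σ.coord u σ.index) = u := by simp [γ]
    have hmem : u ∈ γ '' closure {0}ᶜ :=
      ⟨_, (dense_compl_singleton (0 : ℂ)).closure_eq ▸ trivial, hu'⟩
    refine closure_mono ?_ (image_closure_subset_closure_image hγ hmem)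
    rintro _ ⟨s, hs, rfl⟩
    exact ⟨by simpa [γ] using hs, by simpa [γ] using hu⟩

/-- At a zero `w` with `i`-th coordinate `1` that is not critical, the dehomogenization is still a
submersion, as any direction can be corrected by a multiple of `w`. -/
theorem IsBihomogeneous.surjective_fderiv_dehomogenization {f : MixedPoly 2} {a b : ℕ}
    (hf : IsBihomogeneous f a b) (σ : BlowUpCone) {u : ChartSpace σ}
    (hu : evalMixed f (Function.update (σ.coord u) σ.index 1) = 0)
    (hcrit : ¬ IsMixedCriticalPoint f (Function.update (σ.coord u) σ.index 1)) :
    Function.Surjective (fderiv ℝ (fun u : ChartSpace σ =>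
      evalMixed f (Function.update (σ.coord u) σ.index 1)) u) := by
  set w := Function.update (σ.coord u) σ.index 1 with hw
  let B : ChartSpace σ →L[ℝ] (Fin 2 → ℂ) :=
    (ContinuousLinearMap.pi fun j => if j = σ.index then 0 else
      ContinuousLinearMap.proj (R := ℝ) (φ := fun _ : Fin 2 => ℂ) j).comp
      (σ.coord.toContinuousLinearMap.restrictScalars ℝ)
  have hB : ∀ v, B v = Function.update (σ.coord v) σ.index 0 := by
    intro v
    funext j
    rcases eq_or_ne j σ.index with rfl | hj
    · simp [B]
    · simp [B, hj]
  have hBw : ∀ v, Function.update (σ.coord v) σ.index 1 = B v + Pi.single σ.index 1 := by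
    intro v
    rw [hB]
    funext j
    rcases eq_or_ne j σ.index with rfl | hj
    · simp
    · simp [hj]
  have h1 : HasFDerivAt (fun v : ChartSpace σ => Function.update (σ.coord v) σ.index 1) B u := by
    simp only [hBw]
    exact B.hasFDerivAt.add_const _
  have h2 : HasFDerivAt (evalMixed f) (fderiv ℝ (evalMixed f) w) w :=
    (analyticOnNhd_evalMixed f w trivial).differentiableAt.hasFDerivAt
  have h3 := HasFDerivAt.comp u (f := fun v : ChartSpace σ =>
    Function.update (σ.coord v) σ.index 1) h2 h1
  have h4 : fderiv ℝ (fun u : ChartSpace σ =>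
      evalMixed f (Function.update (σ.coord u) σ.index 1)) u =
      (fderiv ℝ (evalMixed f) w).comp B := h3.fderiv
  rw [h4]
  intro y
  obtain ⟨v, hv⟩ := surjective_fderiv_of_not_isMixedCriticalPoint hcrit y
  have hwi : w σ.index = 1 := by simp [hw]
  refine ⟨σ.coord.symm (v - v σ.index • w), ?_⟩
  rw [ContinuousLinearMap.comp_apply, hB, ContinuousLinearEquiv.apply_symm_apply]
  have : Function.update (v - v σ.index • w) σ.index 0 = v - v σ.index • w := by
    rw [Function.update_eq_self_iff]
    simp [hwi]
  rw [this, map_sub, hv, hf.fderiv_smul_eq_zero hu, sub_zero]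

theorem finrank_real_chartSpace (σ : BlowUpCone) : Module.finrank ℝ (ChartSpace σ) = 4 := by
  rw [finrank_real_of_complex, σ.coord.toLinearEquiv.finrank_eq]
  simp

/-- The strict transform is smooth at every point, not only over the origin. -/
theorem IsBihomogeneous.isAnalyticSubmanifoldAt_strictTransform {f : MixedPoly 2} {a b : ℕ}
    (hf : IsBihomogeneous f a b) (hconv : IsConvenient f)
    (hcrit : ∀ z : Fin 2 → ℂ, (∀ i, z i ≠ 0) → evalMixed f z = 0 → ¬ IsMixedCriticalPoint f z)
    (σ : BlowUpCone) {u : ChartSpace σ}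
    (hu : toricChart σ u ∈ strictTransform f (blowUpFan : Set (Finset (Fin 2 → ℕ)))) :
    IsAnalyticSubmanifoldAt
      (toricChart σ ⁻¹' strictTransform f (blowUpFan : Set (Finset (Fin 2 → ℕ)))) 2 u := by
  rw [← Set.mem_preimage, hf.toricChart_preimage_strictTransform, Set.mem_ofPred_eq] at hu
  rw [hf.toricChart_preimage_strictTransform]
  refine isAnalyticSubmanifoldAt_zeros (by rw [finrank_real_chartSpace]) ?_
    (hf.surjective_fderiv_dehomogenization σ hu (hcrit _ (fun j => ?_) hu))
  · intro v _
    refine (analyticOnNhd_evalMixed f _ trivial).comp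
      (f := fun v : ChartSpace σ => Function.update (σ.coord v) σ.index 1) ?_
    rw [analyticAt_pi_iff]
    intro j
    rcases eq_or_ne j σ.index with rfl | hj
    · simpa using analyticAt_const
    · simp only [Function.update_of_ne hj]
      exact (((ContinuousLinearMap.proj (R := ℂ) (φ := fun _ : Fin 2 => ℂ) j).comp
        σ.coord.toContinuousLinearMap).restrictScalars ℝ).analyticAt v
  · rcases eq_or_ne j σ.index with rfl | hj
    · simp
    · -- by convenience `f` does not vanish on the coordinate axes
      intro hj0
      refine hf.evalMixed_single_ne_zero (hconv {σ.index} (Finset.singleton_nonempty _)) ?_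
      rw [← hu]
      congr 1
      funext k
      rcases eq_or_ne k σ.index with rfl | hk
      · simp
      · have : k = j := by omega
        rw [this, Pi.single_eq_of_ne hj, hj0]

/-! ### Face functions -/

theorem faceFunction_apply_ne_zero {n : ℕ} {f : MixedPoly n} {Δ : Set (Fin n → ℝ)}
    {ν μ : Fin n → ℕ} :
    faceFunction f Δ (ν, μ) ≠ 0 ↔ f (ν, μ) ≠ 0 ∧ toReal (ν + μ) ∈ Δ := by
  classical
  simp only [faceFunction, Finsupp.filter_apply]
  split_ifs with h <;> simp [h]

theorem faceFunction_eq_self {n : ℕ} {f : MixedPoly n} {Δ : Set (Fin n → ℝ)}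
    (h : ∀ ν μ, f (ν, μ) ≠ 0 → toReal (ν + μ) ∈ Δ) : faceFunction f Δ = f := by
  classical
  rw [faceFunction, Finsupp.filter_eq_self_iff]
  exact fun m hm => h m.1 m.2 hm

theorem HasRadialDegree.faceFunction {n : ℕ} {f : MixedPoly n} {Q : Fin n → ℝ} {d : ℕ}
    (h : HasRadialDegree f Q d) (Δ : Set (Fin n → ℝ)) :
    HasRadialDegree (MixedToric.faceFunction f Δ) Q d :=
  ⟨h.1, h.2.1, h.2.2.1, fun ν μ hne => h.2.2.2 ν μ (faceFunction_apply_ne_zero.1 hne).1⟩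

theorem HasPolarDegree.faceFunction {n : ℕ} {f : MixedPoly n} {Q : Fin n → ℝ} {d : ℤ}
    (h : HasPolarDegree f Q d) (Δ : Set (Fin n → ℝ)) :
    HasPolarDegree (MixedToric.faceFunction f Δ) Q d :=
  ⟨h.1, h.2.1, fun ν μ hne => h.2.2 ν μ (faceFunction_apply_ne_zero.1 hne).1⟩

/-- Adding `Eᵢ` to the weight does not change the degrees of a polynomial in the other variable. -/
theorem HasRadialDegree.one_add_stdVec {g : MixedPoly 2} {d : ℕ} {i : Fin 2}
    (h : HasRadialDegree g (fun _ => 1) d) (hi : ∀ ν μ, g (ν, μ) ≠ 0 → ν i = 0 ∧ μ i = 0) :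
    HasRadialDegree g ((fun _ => 1) + toReal (stdVec i)) d := by
  refine ⟨one_add_stdVec_mem_weightCone i, (strictlyPositive_one_add_stdVec i).ne_zero,
    h.2.2.1, fun ν μ hne => ?_⟩
  rw [← h.2.2.2 ν μ hne]
  obtain ⟨h1, h2⟩ := hi ν μ hne
  fin_cases i <;> simp at h1 h2 <;> simp [toReal, stdVec, h1, h2]

theorem HasPolarDegree.one_add_stdVec {g : MixedPoly 2} {d : ℤ} {i : Fin 2}
    (h : HasPolarDegree g (fun _ => 1) d) (hi : ∀ ν μ, g (ν, μ) ≠ 0 → ν i = 0 ∧ μ i = 0) :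
    HasPolarDegree g ((fun _ => 1) + toReal (stdVec i)) d := by
  refine ⟨one_add_stdVec_mem_weightCone i, (strictlyPositive_one_add_stdVec i).ne_zero,
    fun ν μ hne => ?_⟩
  rw [← h.2.2 ν μ hne]
  obtain ⟨h1, h2⟩ := hi ν μ hne
  fin_cases i <;> simp at h1 h2 <;> simp [toReal, stdVec, h1, h2]

/-- Only the vertices that are strictly positive contribute, and `(1, 1)` is the only such vertex of
the fan. -/
theorem lambdaSet_blowUpFan_eq_empty {f : MixedPoly 2} (h : excessSet f {fun _ => 1} = ∅) :
    lambdaSet f (blowUpFan : Set (Finset (Fin 2 → ℕ))) = ∅ := by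
  refine Set.eq_empty_of_forall_notMem ?_
  rintro x ⟨τ, hτ, hpos, ⟨y, ν, μ, Q, hQ, hy⟩, -, -⟩
  have hvert : ∀ τ ∈ blowUpFan, ∀ Q ∈ τ, Q = (fun _ => 1) ∨ Q = stdVec 0 ∨ Q = stdVec 1 := by
    decide
  rcases hvert τ hτ Q hQ with rfl | rfl | rfl
  · exact h.subset ⟨ν, μ, _, Finset.mem_singleton_self _, hy⟩
  · simpa [toReal, stdVec] using hpos _ hQ 1
  · simpa [toReal, stdVec] using hpos _ hQ 0

end MixedToric

theorem mainTheorem4 (f : MixedPoly 2) (r : ℕ) (p : ℤ) (P : Fin 2 → ℝ)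
    (hP : P = fun _ => 1)
    (hconv : IsConvenient f) (hnd : IsNewtonNondegenerate f)
    (hr : HasRadialDegree f P r) (hp : HasPolarDegree f P p) (hp0 : 0 ≤ p) :
    -- the compact faces
    {Δ | IsCompactFace f Δ} =
      {face f P, face f (P + toReal (stdVec 0)), face f (P + toReal (stdVec 1))} ∧
    HasDim (face f P) 1 ∧
    (∀ i : Fin 2, HasDim (face f (P + toReal (stdVec i))) 0) ∧
    -- the degrees of the face functions
    (faceFunction f (face f P) ≠ 0 ∧
      HasRadialDegree (faceFunction f (face f P)) P r ∧
      HasPolarDegree (faceFunction f (face f P)) P p) ∧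
    (∀ i : Fin 2, ∀ g, g = faceFunction f (face f (P + toReal (stdVec i))) →
      g ≠ 0 ∧
      HasRadialDegree g (P + toReal (stdVec i)) r ∧ HasRadialDegree g P r ∧
      HasPolarDegree g (P + toReal (stdVec i)) p ∧ HasPolarDegree g P p) ∧
    -- face type
    IsStronglyPolarNonnegFaceType f ∧
    -- the dual Newton diagram
    DualDiagramIsRegularSubdivision f ∧
    IsAdmissible f (dualSubdivision f) ∧
    IsConvenientSubdivision f (dualSubdivision f) ∧
    -- the toric modification
    IsOrdinaryBlowUp (dualSubdivision f) ∧
    -- the strict transform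
    excessSet f {fun _ => 1} = ∅ ∧
    lambdaSet f (dualSubdivision f) = ∅ ∧
    (AssumptionStar f (dualSubdivision f) →
      IsAnalyticManifoldGerm (strictTransform f (dualSubdivision f))
        (strictTransformOverZero f (dualSubdivision f)) 2) := by
  subst hP
  have hr0 : (0 : ℝ) < r := by exact_mod_cast hr.2.2.1
  obtain ⟨a, b, hbi, hab⟩ := exists_isBihomogeneous hr hp
  have hsingle : ∀ i, evalMixed f (Pi.single i 1) ≠ 0 := fun i =>
    hbi.evalMixed_single_ne_zero (hconv {i} (Finset.singleton_nonempty i))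
  have hf : f ≠ 0 := by
    rintro rfl
    exact hsingle 0 (by simp [evalMixed])
  have hdeg : ∀ ν μ, f (ν, μ) ≠ 0 → toReal (ν + μ) 0 + toReal (ν + μ) 1 = r := by
    intro ν μ h
    rw [← hr.2.2.2 ν μ h]
    simp [toReal]
  have hvert : ∀ i, ∃ ν μ, f (ν, μ) ≠ 0 ∧ toReal (ν + μ) = Pi.single i (r : ℝ) := by
    intro i
    obtain ⟨ν, μ, h, h0⟩ := exists_coeff_ne_zero_of_evalMixed_single (hsingle i)
    have hd := hdeg ν μ h
    have hz : ∀ j, j ≠ i → toReal (ν + μ) j = 0 := fun j hj => by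
      rw [toReal, h0 j hj, Nat.cast_zero]
    refine ⟨ν, μ, h, funext fun j => ?_⟩
    fin_cases i <;> fin_cases j <;> simp_all
  have hΓ := newtonPolyhedron_eq_cornerRegion hr0 hdeg hvert
  have hfan := dualSubdivision_eq_blowUpFan hr0 hΓ
  have hface := face_one hr0 hΓ
  have hsupp : ∀ ν μ, f (ν, μ) ≠ 0 → toReal (ν + μ) ∈ face f (fun _ => 1) := by
    intro ν μ h
    rw [hface]
    exact ⟨Nat.cast_nonneg _, Nat.cast_nonneg _, hdeg ν μ h⟩
  have hfP := faceFunction_eq_self hsupp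
  have hcompact := setOf_isCompactFace_eq hr0 hΓ
  -- the exponents of `f` on the face of `(1, 1) + Eᵢ` involve only the other variable
  have hvar : ∀ i ν μ, faceFunction f (face f ((fun _ => 1) + toReal (stdVec i))) (ν, μ) ≠ 0 →
      ν i = 0 ∧ μ i = 0 := by
    intro i ν μ h
    have h1 := (faceFunction_apply_ne_zero.1 h).2
    rw [face_one_add_stdVec hr0 hΓ, Set.mem_singleton_iff] at h1
    have h2 : ν i + μ i = 0 := by
      have := congrFun h1 i
      rw [Pi.single_eq_of_ne ((by decide : ∀ i : Fin 2, i ≠ i.rev) i)] at this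
      exact Nat.cast_eq_zero.1 this
    omega
  have hrad := fun i => (hr.faceFunction _).one_add_stdVec (hvar i)
  have hpol := fun i => (hp.faceFunction _).one_add_stdVec (hvar i)
  have hexcess : excessSet f {fun _ => 1} = ∅ := by
    refine Set.eq_empty_of_forall_notMem ?_
    rintro x ⟨ν, μ, Q, hQ, hne, hnot, -⟩
    rw [Finset.mem_singleton] at hQ
    subst hQ
    refine hnot ?_
    convert hsupp ν μ hne using 2
    simp [toReal, funext_iff]
  rw [hfan]
  refine ⟨hcompact, hasDim_face_one hr0 hΓ, fun i => ?_, ?_, ?_, ?_, ?_,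
    isAdmissible_blowUpFan hr0 hΓ, ?_, isOrdinaryBlowUp_blowUpFan, hexcess,
    lambdaSet_blowUpFan_eq_empty hexcess, fun _ => ?_⟩
  · rw [face_one_add_stdVec hr0 hΓ]
    exact hasDim_singleton _
  · rw [hfP]
    exact ⟨hf, hr, hp⟩
  · rintro i g rfl
    refine ⟨fun h => ?_, hrad i, hr.faceFunction _, hpol i, hp.faceFunction _⟩
    obtain ⟨ν, μ, hne, hm⟩ := hvert i.rev
    refine faceFunction_apply_ne_zero.2 ⟨hne, ?_⟩ (DFunLike.congr_fun h (ν, μ))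
    rw [face_one_add_stdVec hr0 hΓ]
    exact hm
  · intro Δ hΔ
    rcases hcompact.subset hΔ with rfl | rfl | rfl
    · exact ⟨_, fun _ => zero_lt_one, rfl, ⟨r, hr.faceFunction _⟩, p, hp0, hp.faceFunction _⟩
    · exact ⟨_, strictlyPositive_one_add_stdVec 0, rfl, ⟨r, hrad 0⟩, p, hp0, hpol 0⟩
    · exact ⟨_, strictlyPositive_one_add_stdVec 1, rfl, ⟨r, hrad 1⟩, p, hp0, hpol 1⟩
  · rw [DualDiagramIsRegularSubdivision, hfan]
    exact ⟨(dualNewtonDiagram_eq hr0 hΓ).symm, isRegularSubdivision_blowUpFan hr0 hΓ⟩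
  · intro I hI
    refine stdCone_compl_mem_blowUpFan (Finset.nonempty_iff_ne_empty.2 ?_)
    rintro rfl
    obtain ⟨z, hz, hfz⟩ := hI
    have : z = 0 := funext fun j => hz j (Finset.notMem_empty j)
    rw [this] at hfz
    exact hfz (hbi.evalMixed_zero (hab hf ▸ hr.2.2.1))
  · have hcrit : ∀ z : Fin 2 → ℂ, (∀ i, z i ≠ 0) → evalMixed f z = 0 →
        ¬ IsMixedCriticalPoint f z := by
      have := hnd (face f fun _ => 1) (hcompact.superset (Or.inl rfl))
      rwa [IsNondegenerateOver, hfP] at this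
    exact ⟨Set.univ, isOpen_univ, Set.subset_univ _, fun σ u hu =>
      hbi.isAnalyticSubmanifoldAt_strictTransform hconv hcrit σ hu.1⟩
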